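/- Let $n\ge 1$ be an integer. The Heisenberg group $\mathbb{H}^n$ is $\mathbb{R}^{2n}\times\mathbb{R}$, with points written $x=(x_H,x_T)$, equipped with the product $x*y=(x_H+y_H,\;x_T+y_T+2\langle x_H,Jy_H\rangle)$, where $J=\begin{pmatrix}0&\mathrm{id}\\-\mathrm{id}&0\end{pmatrix}$, and with the Koranyi distance $$d(x,y)=\|x^{-1}*y\|=\left(|y_H-x_H|^4+|y_T-x_T-2\langle x_H,Jy_H\rangle|^2\right)^{1/4},\qquad \|z\|=(|z_H|^4+|z_T|^2)^{1/4}.$$ Let $B_r(x)=\{z: d(z,x)\le r\}$. For $\alpha\ge 0$, a Radon measure $\mu$ on $\mathbb{H}^n$ is called $\alpha$-uniform if $0\in\mathrm{supp}(\mu)$ and $\mu(B_r(x))=r^\alpha$ for every $x\in\mathrm{supp}(\mu)$ and every $r>0$. Theorem. Let $m\in\{1,\dots,2n+1\}\setminus\{2\}$ and let $\mu$ be an $m$-uniform measure on $\mathbb{H}^n$. Then there exist $b\in\mathbb{R}^{2n}$, $\mathcal{T}\in\mathbb{R}$ and a symmetric real $2n\times 2n$ matrix $\mathcal{Q}$ with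 $\mathrm{Tr}(\mathcal{Q})\neq 0$ such that $$\mathrm{supp}(\mu)\subseteq\{(x,t)\in\mathbb{R}^{2n}\times\mathbb{R}:\ \langle b,x\rangle+\langle x,\mathcal{Q}x\rangle+\mathcal{T}t=0\}.$$ -/

import Mathlib

namespace Heisenberg

/-- `ℝ²ⁿ` with its Euclidean structure; the first `n` coordinates are indexed by `Sum.inl`, the last
`n` by `Sum.inr`. -/
abbrev Horizontal (n : ℕ) : Type := EuclideanSpace ℝ (Fin n ⊕ Fin n)

/-- The set underlying the Heisenberg group `ℍⁿ`, namely `ℝ²ⁿ × ℝ`, with its usual topology and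
Borel σ-algebra. For `x : Point n`, `x.1` is the horizontal part `x_H` and `x.2` is the vertical
coordinate `x_T`. The distance of `ℍⁿ` is `Heisenberg.koranyiDist` below, not the product distance
(both induce the same topology). -/
abbrev Point (n : ℕ) : Type := Horizontal n × ℝ

/-- The standard symplectic matrix `J = (0, id; -id, 0)`. -/
def symplecticMatrix (n : ℕ) : Matrix (Fin n ⊕ Fin n) (Fin n ⊕ Fin n) ℝ :=
  Matrix.fromBlocks 0 1 (-1) 0

/-- The group law `x * y = (x_H + y_H, x_T + y_T + 2 ⟨x_H, J y_H⟩)`. -/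
noncomputable def mul {n : ℕ} (x y : Point n) : Point n :=
  (x.1 + y.1, x.2 + y.2 + 2 * inner ℝ x.1 (Matrix.toEuclideanLin (symplecticMatrix n) y.1))

/-- The inverse in the Heisenberg group. -/
def inv {n : ℕ} (x : Point n) : Point n := (-x.1, -x.2)

/-- The Koranyi norm `(|x_H|⁴ + |x_T|²)^(1/4)`. -/
noncomputable def koranyiNorm {n : ℕ} (x : Point n) : ℝ :=
  (‖x.1‖ ^ 4 + |x.2| ^ 2) ^ (1 / 4 : ℝ)

/-- The left-invariant Koranyi distance `d(x, y) = ‖x⁻¹ * y‖`. -/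
noncomputable def koranyiDist {n : ℕ} (x y : Point n) : ℝ := koranyiNorm (mul (inv x) y)

theorem koranyiDist_eq {n : ℕ} (x y : Point n) :
    koranyiDist x y = (‖y.1 - x.1‖ ^ 4 + |y.2 - x.2
      - 2 * inner ℝ x.1 (Matrix.toEuclideanLin (symplecticMatrix n) y.1)| ^ 2) ^ (1 / 4 : ℝ) := by
  have h1 : -x.1 + y.1 = y.1 - x.1 := by abel
  have h2 : ∀ c : ℝ, -x.2 + y.2 + 2 * -c = y.2 - x.2 - 2 * c := fun c => by ring
  simp only [koranyiDist, koranyiNorm, mul, inv, inner_neg_left, h1, h2]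

/-- The Koranyi ball `B_r(x) = {z | d(z, x) ≤ r}`. -/
def koranyiBall {n : ℕ} (x : Point n) (r : ℝ) : Set (Point n) := {z | koranyiDist z x ≤ r}

/-- `μ` is an `α`-uniform measure on `ℍⁿ`: a Radon measure (`MeasureTheory.Measure.Regular`) whose
support contains `0` and such that `μ (B_r(x)) = r ^ α` for all `x` in the support, `r > 0`. -/
structure IsUniform {n : ℕ} (α : ℝ) (μ : MeasureTheory.Measure (Point n)) : Prop where
  radon : μ.Regular
  zero_mem_support : (0 : Point n) ∈ μ.support
  measure_ball : ∀ x ∈ μ.support, ∀ r : ℝ, 0 < r → μ (koranyiBall x r) = ENNReal.ofReal (r ^ α)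

/-- The quadric `𝕂(b, Q, T) = {(x, t) | ⟨b, x⟩ + ⟨x, Q x⟩ + T t = 0}`. -/
def quadric {n : ℕ} (b : Horizontal n) (Q : Matrix (Fin n ⊕ Fin n) (Fin n ⊕ Fin n) ℝ) (T : ℝ) :
    Set (Point n) :=
  {p | inner ℝ b p.1 + inner ℝ p.1 (Matrix.toEuclideanLin Q p.1) + T * p.2 = 0}

end Heisenberg

/-!
Every point `x` of the support of an `m`-uniform measure `μ` sees the same distribution of
distances, so `∫ exp (-s⁴ d(x, z)⁴) dμ(z)` does not depend on `x` (`blowMean_gaussian_eq`). Comparing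
the values at `x` and at `0` and expanding the kernel to second order in `x`, with respect to the
homogeneous degree of the Heisenberg dilations (`exists_abs_exp_koranyiDist_sub_le`), shows that the
quadratic polynomials

  `⟨b_s, x_H⟩ + ⟨x_H, Q_s x_H⟩ + τ_s x_T`

built from Gaussian moments of `μ` at scale `1 / s` tend to `0` as `s → 0` on the support
(`tendsto_approx_zero`). The `Q_s` and `τ_s` are bounded, and the `b_s` are bounded modulo the
orthogonal complement of the horizontal directions of the support, so limits exist along an
ultrafilter and vanish on the support; if `Tr Q_s` does not tend to `0`, the limit can be chosen with
nonzero trace (`exists_quadric_of_tendsto`).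

The trace of `Q_s` is an explicit expression in the horizontal second moment
`G(s) = ∫ exp (-s⁴ ‖z‖⁴) |z_H|² dμ(z)` and its derivative, namely
`(s ^ (2n + 4) G(s))' = s ^ (2n + 1 - m) Tr Q_s / 2`. Since `m ≤ 2n + 1`, integrating shows that
`Tr Q_s → 0` forces `s ^ (m + 2) G(s) → 0` (`tendsto_horizMoment`), and then uniformity forces the
support to be flat against the vertical axis at large scales (`exists_norm_fst_le`). On the vertical
axis the Koranyi distance is the square root of the Euclidean one, so the rescaled vertical
coordinate turns `μ` into a measure on the line that is nearly uniform of dimension `m / 2`. Such a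
measure has no gaps, and comparing an interval with its two halves gives `2 ^ (m / 2) = 2`, that is,
`m = 2` (`IsApproxUniform.eq_two`). This case is excluded.
-/

namespace Heisenberg

open MeasureTheory Filter Topology Set

variable {n : ℕ}

/-! ### The Koranyi norm and dilations -/

/-- The action of the symplectic matrix `J` on horizontal vectors. -/
noncomputable def sympl (n : ℕ) : Horizontal n →ₗ[ℝ] Horizontal n :=
  Matrix.toEuclideanLin (symplecticMatrix n)

@[simp]
theorem sympl_apply_inl (v : Horizontal n) (i : Fin n) :
    sympl n v (Sum.inl i) = v (Sum.inr i) := by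
  simp [sympl, symplecticMatrix, Matrix.toLpLin_apply, Matrix.mulVec, dotProduct,
    Matrix.one_apply]

@[simp]
theorem sympl_apply_inr (v : Horizontal n) (i : Fin n) :
    sympl n v (Sum.inr i) = -v (Sum.inl i) := by
  simp [sympl, symplecticMatrix, Matrix.toLpLin_apply, Matrix.mulVec, dotProduct,
    Matrix.one_apply]

theorem inner_sympl_swap (v w : Horizontal n) : inner ℝ v (sympl n w) = -inner ℝ w (sympl n v) := by
  simp only [PiLp.inner_apply, Fintype.sum_sum_type, sympl_apply_inl, sympl_apply_inr]
  simp [Finset.sum_neg_distrib, mul_comm]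

theorem inner_sympl_self (v : Horizontal n) : inner ℝ v (sympl n v) = 0 := by
  linarith [inner_sympl_swap v v]

theorem norm_sympl (v : Horizontal n) : ‖sympl n v‖ = ‖v‖ := by
  rw [EuclideanSpace.norm_eq, EuclideanSpace.norm_eq]
  congr 1
  simp [Fintype.sum_sum_type, add_comm]

theorem continuous_sympl : Continuous (sympl n) := (sympl n).continuous_of_finiteDimensional

theorem abs_apply_le_norm (v : Horizontal n) (i : Fin n ⊕ Fin n) : |v i| ≤ ‖v‖ :=
  PiLp.norm_apply_le v i

theorem abs_inner_sympl_le (v w : Horizontal n) : |inner ℝ v (sympl n w)| ≤ ‖v‖ * ‖w‖ := by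
  simpa [norm_sympl] using abs_real_inner_le_norm v (sympl n w)

theorem koranyiNorm_nonneg (z : Point n) : 0 ≤ koranyiNorm z := by
  unfold koranyiNorm; positivity

theorem koranyiNorm_pow_four (z : Point n) : koranyiNorm z ^ 4 = ‖z.1‖ ^ 4 + z.2 ^ 2 := by
  unfold koranyiNorm
  rw [← Real.rpow_natCast, ← Real.rpow_mul (by positivity)]
  norm_num

theorem norm_fst_le_koranyiNorm (z : Point n) : ‖z.1‖ ≤ koranyiNorm z := by
  refine le_of_pow_le_pow_left₀ (n := 4) (by norm_num) (koranyiNorm_nonneg z) ?_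
  rw [koranyiNorm_pow_four]; nlinarith [sq_nonneg z.2]

theorem abs_snd_le_koranyiNorm_sq (z : Point n) : |z.2| ≤ koranyiNorm z ^ 2 := by
  refine abs_le_of_sq_le_sq ?_ (by positivity)
  rw [← pow_mul, koranyiNorm_pow_four]
  nlinarith [pow_nonneg (norm_nonneg z.1) 4]

theorem continuous_koranyiNorm : Continuous (koranyiNorm (n := n)) := by
  unfold koranyiNorm
  exact Continuous.rpow_const (by fun_prop) (fun _ => Or.inr (by norm_num))

theorem koranyiDist_pow_four (x z : Point n) : koranyiDist x z ^ 4
    = ‖z.1 - x.1‖ ^ 4 + (z.2 - x.2 - 2 * inner ℝ x.1 (sympl n z.1)) ^ 2 := by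
  rw [koranyiDist_eq, ← Real.rpow_natCast, ← Real.rpow_mul (by positivity)]
  norm_num [sympl]

theorem koranyiDist_nonneg (x z : Point n) : 0 ≤ koranyiDist x z := koranyiNorm_nonneg _

theorem koranyiDist_comm (x z : Point n) : koranyiDist x z = koranyiDist z x := by
  rw [← pow_left_inj₀ (koranyiDist_nonneg _ _) (koranyiDist_nonneg _ _) (n := 4) (by norm_num),
    koranyiDist_pow_four, koranyiDist_pow_four, norm_sub_rev, inner_sympl_swap x.1]
  ring

theorem koranyiDist_zero (z : Point n) : koranyiDist 0 z = koranyiNorm z := by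
  rw [← pow_left_inj₀ (koranyiDist_nonneg _ _) (koranyiNorm_nonneg _) (n := 4) (by norm_num),
    koranyiDist_pow_four, koranyiNorm_pow_four]
  simp

theorem continuous_koranyiDist (x : Point n) : Continuous (koranyiDist x) := by
  have : Continuous fun z : Point n => mul (inv x) z := by
    have h := continuous_sympl (n := n)
    unfold mul
    change Continuous fun z : Point n =>
      ((inv x).1 + z.1, (inv x).2 + z.2 + 2 * inner ℝ (inv x).1 (sympl n z.1))
    fun_prop
  exact continuous_koranyiNorm.comp this

/-- The dilation `(x_H, x_T) ↦ (s x_H, s² x_T)` of the Heisenberg group. -/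
def dil (s : ℝ) (z : Point n) : Point n := (s • z.1, s ^ 2 * z.2)

theorem continuous_dil (s : ℝ) : Continuous (dil (n := n) s) := by
  unfold dil; fun_prop

theorem koranyiNorm_dil {s : ℝ} (hs : 0 ≤ s) (z : Point n) :
    koranyiNorm (dil s z) = s * koranyiNorm z := by
  rw [← pow_left_inj₀ (koranyiNorm_nonneg _) (mul_nonneg hs (koranyiNorm_nonneg _)) (n := 4)
    (by norm_num), mul_pow, koranyiNorm_pow_four, koranyiNorm_pow_four]
  simp only [dil, norm_smul, Real.norm_eq_abs, abs_of_nonneg hs]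
  ring

theorem koranyiDist_dil {s : ℝ} (hs : 0 ≤ s) (x z : Point n) :
    koranyiDist (dil s x) (dil s z) = s * koranyiDist x z := by
  rw [← pow_left_inj₀ (koranyiDist_nonneg _ _) (mul_nonneg hs (koranyiDist_nonneg _ _)) (n := 4)
    (by norm_num), mul_pow, koranyiDist_pow_four, koranyiDist_pow_four]
  simp only [dil, ← smul_sub, norm_smul, Real.norm_eq_abs, abs_of_nonneg hs, map_smul,
    real_inner_smul_left, real_inner_smul_right]
  ring

/-! ### Second-order expansion of the Gaussian kernel -/

/-- The vector `|w_H|² w_H + w_T J w_H`; it is `-1/4` times the gradient at `y = 0` of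
`y ↦ d(y, w)⁴` in the horizontal directions. -/
noncomputable def gradVec (w : Point n) : Horizontal n := ‖w.1‖ ^ 2 • w.1 + w.2 • sympl n w.1

/-- The terms of degree `1` and `2` in `y` (for the homogeneous degree in which `y_T` has degree
`2`) of `(d(y, w)⁴ - ‖w‖⁴) - (d(y, w)⁴ - ‖w‖⁴)² / 2`. -/
noncomputable def secondOrder (y w : Point n) : ℝ :=
  -4 * inner ℝ (gradVec w) y.1
    + (4 * inner ℝ w.1 y.1 ^ 2 + 2 * ‖w.1‖ ^ 2 * ‖y.1‖ ^ 2 - 2 * w.2 * y.2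
      + 4 * inner ℝ (sympl n w.1) y.1 ^ 2)
    - 8 * inner ℝ (gradVec w) y.1 ^ 2

theorem inner_gradVec (w y : Point n) : inner ℝ (gradVec w) y.1
    = ‖w.1‖ ^ 2 * inner ℝ w.1 y.1 + w.2 * inner ℝ (sympl n w.1) y.1 := by
  simp [gradVec, inner_add_left, real_inner_smul_left]

theorem koranyiDist_pow_four_sub (y w : Point n) :
    koranyiDist y w ^ 4 - koranyiNorm w ^ 4 = -4 * inner ℝ (gradVec w) y.1
    + (4 * inner ℝ w.1 y.1 ^ 2 + 2 * ‖w.1‖ ^ 2 * ‖y.1‖ ^ 2 - 2 * w.2 * y.2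
      + 4 * inner ℝ (sympl n w.1) y.1 ^ 2)
    + (-4 * inner ℝ w.1 y.1 * ‖y.1‖ ^ 2 + 4 * y.2 * inner ℝ (sympl n w.1) y.1
      + ‖y.1‖ ^ 4 + y.2 ^ 2) := by
  have h : ‖w.1 - y.1‖ ^ 4 = (‖w.1‖ ^ 2 - 2 * inner ℝ w.1 y.1 + ‖y.1‖ ^ 2) ^ 2 := by
    rw [← norm_sub_sq_real]; ring
  rw [koranyiDist_pow_four, koranyiNorm_pow_four, h, inner_gradVec,
    real_inner_comm (sympl n w.1) y.1]
  ring

theorem abs_exp_neg_sub_le (L : ℝ) :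
    |Real.exp (-L) - (1 - L + L ^ 2 / 2)| ≤ |L| ^ 3 * Real.exp |L| := by
  have h := Complex.norm_exp_sub_sum_le_norm_mul_exp (-(L : ℂ)) 3
  simp only [Finset.sum_range_succ, Finset.sum_range_zero, norm_neg, Complex.norm_real,
    Real.norm_eq_abs] at h
  rw [← Real.norm_eq_abs, ← Complex.norm_real]
  convert h using 2
  push_cast
  simp
  ring

/-- Powers are absorbed by the Gaussian `exp (-u⁴ / 2)`. -/
theorem pow_mul_exp_neg_le {u : ℝ} (hu : 0 ≤ u) {k : ℕ} (hk : k ≤ 9) :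
    (1 + u) ^ k * Real.exp (1 - u ^ 4 / 2) ≤ (Nat.factorial 9 * Real.exp 5) * Real.exp (-u) := by
  have h9 : (1 + u) ^ 9 ≤ Nat.factorial 9 * Real.exp (1 + u) := by
    have := Real.pow_div_factorial_le_exp (1 + u) (by positivity) 9
    rwa [div_le_iff₀' (by positivity)] at this
  calc (1 + u) ^ k * Real.exp (1 - u ^ 4 / 2)
      ≤ (Nat.factorial 9 * Real.exp (1 + u)) * Real.exp (1 - u ^ 4 / 2) := by
        gcongr
        exact (pow_le_pow_right₀ (by linarith) hk).trans h9
    _ = Nat.factorial 9 * Real.exp ((1 + u) + (1 - u ^ 4 / 2)) := by rw [mul_assoc, ← Real.exp_add]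
    _ ≤ Nat.factorial 9 * Real.exp (5 + -u) := by
        refine mul_le_mul_of_nonneg_left (Real.exp_le_exp.2 ?_) (by positivity)
        nlinarith [sq_nonneg (u ^ 2 - 1), sq_nonneg (u - 1)]
    _ = _ := by rw [Real.exp_add]; ring

theorem abs_inner_gradVec_le (w y : Point n) :
    |inner ℝ (gradVec w) y.1| ≤ 2 * koranyiNorm w ^ 3 * koranyiNorm y := by
  have hw := norm_fst_le_koranyiNorm w
  have hw2 := abs_snd_le_koranyiNorm_sq w
  have hy := norm_fst_le_koranyiNorm y
  have hN := koranyiNorm_nonneg w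
  rw [inner_gradVec]
  have h1 := abs_real_inner_le_norm w.1 y.1
  have h2 : |inner ℝ (sympl n w.1) y.1| ≤ ‖w.1‖ * ‖y.1‖ := by
    simpa [norm_sympl] using abs_real_inner_le_norm (sympl n w.1) y.1
  calc _ ≤ |‖w.1‖ ^ 2 * inner ℝ w.1 y.1| + |w.2 * inner ℝ (sympl n w.1) y.1| := abs_add_le _ _
    _ = ‖w.1‖ ^ 2 * |inner ℝ w.1 y.1| + |w.2| * |inner ℝ (sympl n w.1) y.1| := by
        rw [abs_mul, abs_mul, abs_of_nonneg (by positivity : (0:ℝ) ≤ ‖w.1‖ ^ 2)]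
    _ ≤ koranyiNorm w ^ 2 * (koranyiNorm w * koranyiNorm y)
        + koranyiNorm w ^ 2 * (koranyiNorm w * koranyiNorm y) := by
        gcongr
        · exact h1.trans (by gcongr)
        · exact h2.trans (by gcongr)
    _ = _ := by ring

/-- The second-order expansion of `exp (-(u⁴ + L))` when `L` splits as `-4 g + P₂ + P₃` with terms
of order `d`, `d²` and `d³`. -/
theorem abs_exp_neg_add_sub_le {d u g P2 P3 L : ℝ} (hd0 : 0 ≤ d) (hu0 : 0 ≤ u)
    (hd1 : 40000 * d ≤ 1) (hL : L = -4 * g + P2 + P3) (bP1 : |4 * g| ≤ 8 * (d * (1 + u) ^ 3))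
    (bP2 : |P2| ≤ 12 * (d ^ 2 * (1 + u) ^ 3)) (bP3 : |P3| ≤ 9 * (d ^ 3 * (1 + u) ^ 3)) :
    |Real.exp (-(u ^ 4 + L)) - Real.exp (-u ^ 4) + Real.exp (-u ^ 4) * (-4 * g + P2 - 8 * g ^ 2)|
      ≤ 40000 * (Nat.factorial 9 * Real.exp 5) * d ^ 3 * Real.exp (-u) := by
  have hp1 : 1 ≤ 1 + u := by linarith
  have hdle : d ≤ 1 := by linarith
  -- `29 d (1 + u)³` will bound `|L|`; as `d` is small, `exp |L|` costs at most half of `exp (-u⁴)`.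
  have hexp : 29 * (d * (1 + u) ^ 3) ≤ 1 + u ^ 4 / 2 := by
    have h1 : (1 + u) ^ 3 ≤ 8 + 4 * u ^ 4 := by
      nlinarith [sq_nonneg (u ^ 2 - 1), sq_nonneg (u - 1), sq_nonneg (u ^ 2 - u),
        mul_nonneg hu0 (sq_nonneg (u - 1))]
    have h2 : 40000 * d * (1 + u) ^ 3 ≤ 1 * (1 + u) ^ 3 := by gcongr
    have h3 : 0 ≤ u ^ 4 := by positivity
    linarith
  generalize hp : 1 + u = p at *
  have hd2 : d ^ 2 * p ^ 3 ≤ d * p ^ 3 := by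
    refine mul_le_mul_of_nonneg_right ?_ (by positivity)
    exact pow_le_of_le_one hd0 hdle (by norm_num)
  have hd3 : d ^ 3 * p ^ 3 ≤ d ^ 2 * p ^ 3 := by
    exact mul_le_mul_of_nonneg_right (pow_le_pow_of_le_one hd0 hdle (by norm_num)) (by positivity)
  have bL : |L| ≤ 29 * (d * p ^ 3) := by
    rw [hL, abs_le]
    rw [abs_le] at bP1 bP2 bP3
    constructor <;> linarith
  have bd : |L + 4 * g| ≤ 21 * (d ^ 2 * p ^ 3) := by
    rw [hL, abs_le]
    rw [abs_le] at bP2 bP3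
    constructor <;> linarith
  have bs : |L - 4 * g| ≤ 37 * (d * p ^ 3) := by
    rw [abs_le] at bP1 bL ⊢
    constructor <;> linarith
  have bT : |P3 - (L ^ 2 - (4 * g) ^ 2) / 2| ≤ 400 * (d ^ 3 * p ^ 9) := by
    have h1 : |(L ^ 2 - (4 * g) ^ 2) / 2| ≤ (21 * (d ^ 2 * p ^ 3)) * (37 * (d * p ^ 3)) / 2 := by
      rw [show (L ^ 2 - (4 * g) ^ 2) / 2 = (L + 4 * g) * (L - 4 * g) / 2 by ring, abs_div, abs_mul,
        abs_of_pos (by norm_num : (0:ℝ) < 2)]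
      gcongr
    have h2 : d ^ 3 * p ^ 3 ≤ d ^ 3 * p ^ 9 := by
      refine mul_le_mul_of_nonneg_left (pow_le_pow_right₀ hp1 (by norm_num)) (by positivity)
    have h3 : d ^ 3 * p ^ 6 ≤ d ^ 3 * p ^ 9 := by
      refine mul_le_mul_of_nonneg_left (pow_le_pow_right₀ hp1 (by norm_num)) (by positivity)
    have h4 : 21 * (d ^ 2 * p ^ 3) * (37 * (d * p ^ 3)) / 2 = 777 / 2 * (d ^ 3 * p ^ 6) := by ring
    refine (abs_sub _ _).trans ?_
    linarith [(by positivity : 0 ≤ d ^ 3 * p ^ 9)]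
  have hTay := abs_exp_neg_sub_le L
  have e1 : Real.exp (-(u ^ 4 + L)) = Real.exp (-u ^ 4) * Real.exp (-L) := by
    rw [← Real.exp_add]; ring_nf
  have e2 : Real.exp (-(u ^ 4 + L)) - Real.exp (-u ^ 4)
      + Real.exp (-u ^ 4) * (-4 * g + P2 - 8 * g ^ 2)
      = Real.exp (-u ^ 4) * ((Real.exp (-L) - (1 - L + L ^ 2 / 2))
        - (P3 - (L ^ 2 - (4 * g) ^ 2) / 2)) := by
    rw [e1]
    linear_combination (-Real.exp (-u ^ 4)) * hL
  rw [e2, abs_mul, abs_of_pos (Real.exp_pos _)]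
  have hR : |(Real.exp (-L) - (1 - L + L ^ 2 / 2)) - (P3 - (L ^ 2 - (4 * g) ^ 2) / 2)|
      ≤ 40000 * (d ^ 3 * p ^ 9) * Real.exp (1 + u ^ 4 / 2) := by
    have h1 : |L| ^ 3 * Real.exp |L| ≤ (29 * (d * p ^ 3)) ^ 3 * Real.exp (1 + u ^ 4 / 2) := by
      gcongr
      exact bL.trans hexp
    have h2 : 400 * (d ^ 3 * p ^ 9) ≤ 400 * (d ^ 3 * p ^ 9) * Real.exp (1 + u ^ 4 / 2) :=
      le_mul_of_one_le_right (by positivity) (Real.one_le_exp (by positivity))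
    have h3 : 0 ≤ (d ^ 3 * p ^ 9) * Real.exp (1 + u ^ 4 / 2) := by positivity
    have h4 : (29 * (d * p ^ 3)) ^ 3 * Real.exp (1 + u ^ 4 / 2)
        = 24389 * ((d ^ 3 * p ^ 9) * Real.exp (1 + u ^ 4 / 2)) := by ring
    refine (abs_sub _ _).trans ?_
    linarith
  calc Real.exp (-u ^ 4) * _
      ≤ Real.exp (-u ^ 4) * (40000 * (d ^ 3 * p ^ 9) * Real.exp (1 + u ^ 4 / 2)) := by gcongr
    _ = 40000 * d ^ 3 * (p ^ 9 * Real.exp (1 - u ^ 4 / 2)) := by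
        rw [show Real.exp (1 - u ^ 4 / 2) = Real.exp (-u ^ 4) * Real.exp (1 + u ^ 4 / 2) by
          rw [← Real.exp_add]; ring_nf]
        ring
    _ ≤ 40000 * d ^ 3 * ((Nat.factorial 9 * Real.exp 5) * Real.exp (-u)) := by
        refine mul_le_mul_of_nonneg_left ?_ (by positivity)
        rw [← hp]
        exact pow_mul_exp_neg_le hu0 le_rfl
    _ = _ := by ring

/-- Taylor expansion of `exp (-d(y, w)⁴)` at `y = 0`, with a remainder of homogeneous degree `3`
in `y` that is still integrable in `w`. -/
theorem exists_abs_exp_koranyiDist_sub_le (n : ℕ) : ∃ K : ℝ, 0 < K ∧ ∀ y w : Point n,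
    K * koranyiNorm y ≤ 1 →
    |Real.exp (-koranyiDist y w ^ 4) - Real.exp (-koranyiNorm w ^ 4)
      + Real.exp (-koranyiNorm w ^ 4) * secondOrder y w|
      ≤ K * koranyiNorm y ^ 3 * Real.exp (-koranyiNorm w) := by
  refine ⟨40000 * (Nat.factorial 9 * Real.exp 5), by positivity, fun y w hy => ?_⟩
  set d := koranyiNorm y with hd
  set u := koranyiNorm w with hu
  have hd0 : 0 ≤ d := koranyiNorm_nonneg y
  have hu0 : 0 ≤ u := koranyiNorm_nonneg w
  have hd1 : 40000 * d ≤ 1 := by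
    refine le_trans ?_ hy
    have : (1 : ℝ) ≤ Nat.factorial 9 * Real.exp 5 := by
      have h1 : (1 : ℝ) ≤ Real.exp 5 := Real.one_le_exp (by norm_num)
      have h2 : (1 : ℝ) ≤ Nat.factorial 9 := by
        exact_mod_cast Nat.succ_le_of_lt (Nat.factorial_pos 9)
      nlinarith
    nlinarith
  have hw1 : ‖w.1‖ ≤ u := norm_fst_le_koranyiNorm w
  have hw2 : |w.2| ≤ u ^ 2 := abs_snd_le_koranyiNorm_sq w
  have hy1 : ‖y.1‖ ≤ d := norm_fst_le_koranyiNorm y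
  have hy2 : |y.2| ≤ d ^ 2 := abs_snd_le_koranyiNorm_sq y
  have hi : |inner ℝ w.1 y.1| ≤ u * d :=
    (abs_real_inner_le_norm w.1 y.1).trans (by gcongr)
  have hj : |inner ℝ (sympl n w.1) y.1| ≤ u * d := by
    refine (abs_real_inner_le_norm (sympl n w.1) y.1).trans ?_
    rw [norm_sympl]; gcongr
  have hP1 := abs_inner_gradVec_le w y
  have hL := koranyiDist_pow_four_sub y w
  set g : ℝ := inner ℝ (gradVec w) y.1
  set a : ℝ := inner ℝ w.1 y.1
  set b : ℝ := inner ℝ (sympl n w.1) y.1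
  set P2 := 4 * a ^ 2 + 2 * ‖w.1‖ ^ 2 * ‖y.1‖ ^ 2 - 2 * w.2 * y.2 + 4 * b ^ 2 with hP2def
  set P3 := -4 * a * ‖y.1‖ ^ 2 + 4 * y.2 * b + ‖y.1‖ ^ 4 + y.2 ^ 2 with hP3def
  set p := 1 + u with hp
  have hp1 : 1 ≤ p := by linarith
  have hup : u ≤ p := by linarith
  have hdle : d ≤ 1 := by linarith
  have hg : secondOrder y w = -4 * g + P2 - 8 * g ^ 2 := rfl
  have ha2 : a ^ 2 ≤ (u * d) ^ 2 := sq_le_sq' (abs_le.1 hi).1 (abs_le.1 hi).2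
  have hb2 : b ^ 2 ≤ (u * d) ^ 2 := sq_le_sq' (abs_le.1 hj).1 (abs_le.1 hj).2
  have hwy : |w.2 * y.2| ≤ u ^ 2 * d ^ 2 := by rw [abs_mul]; gcongr
  have hwy' : ‖w.1‖ ^ 2 * ‖y.1‖ ^ 2 ≤ u ^ 2 * d ^ 2 := by gcongr
  have hay : |a * ‖y.1‖ ^ 2| ≤ (u * d) * d ^ 2 := by
    rw [abs_mul, abs_of_nonneg (by positivity : (0:ℝ) ≤ ‖y.1‖ ^ 2)]; gcongr
  have hby : |y.2 * b| ≤ d ^ 2 * (u * d) := by rw [abs_mul]; gcongr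
  have hy4 : ‖y.1‖ ^ 4 + y.2 ^ 2 = d ^ 4 := (koranyiNorm_pow_four y).symm
  have bP1 : |4 * g| ≤ 8 * (d * p ^ 3) := by
    rw [abs_mul, abs_of_pos (by norm_num : (0:ℝ) < 4)]
    have h1 : u ^ 3 * d ≤ p ^ 3 * d := by gcongr
    linarith
  have hu2 : u ^ 2 ≤ p ^ 3 := by
    calc u ^ 2 ≤ p ^ 2 := by gcongr
      _ ≤ p ^ 3 := pow_le_pow_right₀ hp1 (by norm_num)
  have bP2 : |P2| ≤ 12 * (d ^ 2 * p ^ 3) := by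
    have h12 : |P2| ≤ 12 * (d ^ 2 * u ^ 2) := by
      rw [abs_le] at hwy ⊢
      have h0 : 0 ≤ ‖w.1‖ ^ 2 * ‖y.1‖ ^ 2 := by positivity
      have h1 := sq_nonneg a
      have h2 := sq_nonneg b
      have h3 : (u * d) ^ 2 = u ^ 2 * d ^ 2 := mul_pow _ _ _
      constructor <;> linarith
    exact h12.trans (by gcongr)
  have bP3 : |P3| ≤ 9 * (d ^ 3 * p ^ 3) := by
    have h1 : |P3| ≤ 8 * (d ^ 3 * u) + d ^ 4 := by
      rw [abs_le] at hay hby ⊢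
      have h0 : 0 ≤ d ^ 4 := by positivity
      have h1 : u * d * d ^ 2 = d ^ 3 * u := by ring
      have h2 : d ^ 2 * (u * d) = d ^ 3 * u := by ring
      constructor <;> linarith
    have h2 : d ^ 4 ≤ d ^ 3 * p ^ 3 := by
      have : d ^ 4 = d ^ 3 * d := by ring
      rw [this]; gcongr
      exact hdle.trans (one_le_pow₀ hp1)
    have h3 : d ^ 3 * u ≤ d ^ 3 * p ^ 3 := by
      gcongr
      exact hup.trans (le_self_pow₀ hp1 (by norm_num))
    linarith
  have key := abs_exp_neg_add_sub_le hd0 hu0 hd1 hL bP1 bP2 bP3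
  rw [hg, ← show u ^ 4 + (koranyiDist y w ^ 4 - u ^ 4) = koranyiDist y w ^ 4 by ring]
  exact key

/-! ### Radial integrals against a uniform measure -/

/-- The distribution `m r^(m-1) dr` on `(0, ∞)` of the distance to a point of the support of an
`m`-uniform measure. -/
noncomputable def radial (m : ℕ) : Measure ℝ :=
  (volume.restrict (Ioi 0)).withDensity fun r => ENNReal.ofReal (m * r ^ (m - 1))

theorem radial_Iic_of_nonpos (m : ℕ) {a : ℝ} (ha : a ≤ 0) : radial m (Iic a) = 0 := by
  rw [radial, withDensity_apply _ measurableSet_Iic, Measure.restrict_restrict measurableSet_Iic]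
  have : Iic a ∩ Ioi 0 = ∅ := by
    ext r; simp only [mem_inter_iff, mem_Iic, mem_Ioi, mem_empty_iff_false]; constructor
    · rintro ⟨h1, h2⟩; linarith
    · exact False.elim
  simp [this]

theorem radial_Iic_of_pos {m : ℕ} (hm : 1 ≤ m) {a : ℝ} (ha : 0 < a) :
    radial m (Iic a) = ENNReal.ofReal (a ^ m) := by
  rw [radial, withDensity_apply _ measurableSet_Iic, Measure.restrict_restrict measurableSet_Iic,
    inter_comm, Ioi_inter_Iic, ← ofReal_integral_eq_lintegral_ofReal,
    ← intervalIntegral.integral_of_le ha.le, intervalIntegral.integral_const_mul, integral_pow]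
  · congr 1
    obtain ⟨k, rfl⟩ : ∃ k, m = k + 1 := ⟨m - 1, by omega⟩
    simp
    field_simp
  · exact (Continuous.integrableOn_Icc (by fun_prop)).mono_set Ioc_subset_Icc_self
  · filter_upwards [ae_restrict_mem measurableSet_Ioc] with r hr
    have := hr.1.le
    positivity

theorem measure_koranyiBall {m : ℕ} {μ : Measure (Point n)} (hμ : IsUniform (m : ℝ) μ)
    {x : Point n} (hx : x ∈ μ.support) {r : ℝ} (hr : 0 < r) :
    μ (koranyiBall x r) = ENNReal.ofReal (r ^ m) := by
  rw [hμ.measure_ball x hx r hr, Real.rpow_natCast]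

theorem preimage_koranyiDist_Iic (x : Point n) (r : ℝ) :
    koranyiDist x ⁻¹' Iic r = koranyiBall x r := by
  ext z; simp [koranyiBall, koranyiDist_comm x z]

/-- Uniformity determines the distribution of the distance to every point of the support. -/
theorem map_koranyiDist_eq_radial {m : ℕ} (hm : 1 ≤ m) {μ : Measure (Point n)}
    (hμ : IsUniform (m : ℝ) μ) {x : Point n} (hx : x ∈ μ.support) :
    μ.map (koranyiDist x) = radial m := by
  have hmap : ∀ a, μ.map (koranyiDist x) (Iic a) = μ (koranyiBall x a) := fun a => by
    rw [Measure.map_apply (continuous_koranyiDist x).measurable measurableSet_Iic,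
      preimage_koranyiDist_Iic]
  refine Measure.ext_of_generateFrom_of_iUnion (range Iic) (fun k : ℕ => Iic ((k : ℝ) + 1))
    ?_ isPiSystem_Iic ?_ (fun k => ⟨_, rfl⟩) ?_ ?_
  · rw [BorelSpace.measurable_eq (α := ℝ), borel_eq_generateFrom_Iic]
  · refine iUnion_eq_univ_iff.2 fun r => ?_
    obtain ⟨k, hk⟩ := exists_nat_ge r
    exact ⟨k, hk.trans (by linarith)⟩
  · intro k
    rw [hmap, measure_koranyiBall hμ hx (by positivity)]
    exact ENNReal.ofReal_ne_top
  · rintro _ ⟨a, rfl⟩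
    rw [hmap]
    rcases lt_or_ge 0 a with ha | ha
    · rw [measure_koranyiBall hμ hx ha, radial_Iic_of_pos hm ha]
    · rw [radial_Iic_of_nonpos m ha]
      have hlim : Tendsto (fun r : ℝ => ENNReal.ofReal (r ^ m)) (𝓝[>] 0) (𝓝 0) := by
        have : Tendsto (fun r : ℝ => ENNReal.ofReal (r ^ m)) (𝓝 0) (𝓝 (ENNReal.ofReal (0 ^ m))) :=
          (ENNReal.continuous_ofReal.comp (continuous_pow m)).tendsto 0
        rw [zero_pow (by omega), ENNReal.ofReal_zero] at this
        exact this.mono_left nhdsWithin_le_nhds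
      refine le_antisymm (ge_of_tendsto hlim ?_) zero_le
      filter_upwards [self_mem_nhdsWithin] with r hr
      rw [← measure_koranyiBall hμ hx hr]
      exact measure_mono fun z (hz : _ ≤ a) => hz.trans (ha.trans (le_of_lt hr))

theorem integral_comp_koranyiDist {m : ℕ} (hm : 1 ≤ m) {μ : Measure (Point n)}
    (hμ : IsUniform (m : ℝ) μ) {x : Point n} (hx : x ∈ μ.support) {f : ℝ → ℝ}
    (hf : Continuous f) : ∫ z, f (koranyiDist x z) ∂μ = ∫ r, f r ∂radial m := by
  rw [← map_koranyiDist_eq_radial hm hμ hx,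
    integral_map (continuous_koranyiDist x).aemeasurable hf.aestronglyMeasurable]

theorem integral_exp_neg_mul_radial {m : ℕ} (hm : 1 ≤ m) {s : ℝ} (hs : 0 < s) :
    s ^ m * ∫ r, Real.exp (-(s * r)) ∂radial m = m.factorial := by
  rw [radial, integral_withDensity_eq_integral_toReal_smul (by fun_prop)
    (ae_of_all _ fun _ => ENNReal.ofReal_lt_top)]
  have h1 : ∫ r in Ioi (0 : ℝ), (ENNReal.ofReal (m * r ^ (m - 1))).toReal • Real.exp (-(s * r))
      = m * ∫ r in Ioi (0 : ℝ), r ^ ((m : ℝ) - 1) * Real.exp (-(s * r)) := by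
    rw [← integral_const_mul]
    refine setIntegral_congr_fun measurableSet_Ioi fun r hr => ?_
    have hr' : (0 : ℝ) < r := hr
    simp only [smul_eq_mul]
    rw [ENNReal.toReal_ofReal (by positivity), ← Real.rpow_natCast, Nat.cast_sub hm, Nat.cast_one,
      mul_assoc]
  rw [h1, Real.integral_rpow_mul_exp_neg_mul_Ioi (by positivity) hs]
  obtain ⟨k, rfl⟩ : ∃ k, m = k + 1 := ⟨m - 1, by omega⟩
  rw [Nat.cast_add_one, Real.Gamma_nat_eq_factorial, Nat.factorial_succ,
    show ((k : ℝ) + 1) = ((k + 1 : ℕ) : ℝ) by push_cast; ring, Real.rpow_natCast]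
  push_cast
  rw [one_div, inv_pow]
  field_simp

/-- The mean of `f` at scale `1 / s`: the integral of `f` against the blow-down of `μ` by `s`. -/
noncomputable def blowMean (m : ℕ) (μ : Measure (Point n)) (s : ℝ) (f : Point n → ℝ) : ℝ :=
  s ^ m * ∫ z, f (dil s z) ∂μ

/-- Continuous functions bounded by a multiple of `exp (-‖w‖)`. -/
def ExpDominated (f : Point n → ℝ) : Prop :=
  Continuous f ∧ ∃ K, ∀ w, |f w| ≤ K * Real.exp (-koranyiNorm w)

theorem blowMean_exp_neg {m : ℕ} (hm : 1 ≤ m) {μ : Measure (Point n)}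
    (hμ : IsUniform (m : ℝ) μ) {s : ℝ} (hs : 0 < s) :
    blowMean m μ s (fun w => Real.exp (-koranyiNorm w)) = m.factorial := by
  simp only [blowMean, koranyiNorm_dil hs.le, ← koranyiDist_zero (n := n)]
  rw [integral_comp_koranyiDist hm hμ hμ.zero_mem_support (f := fun r => Real.exp (-(s * r)))
    (by fun_prop), integral_exp_neg_mul_radial hm hs]

theorem integrable_exp_neg {m : ℕ} (hm : 1 ≤ m) {μ : Measure (Point n)}
    (hμ : IsUniform (m : ℝ) μ) {s : ℝ} (hs : 0 < s) :
    Integrable (fun z => Real.exp (-koranyiNorm (dil s z))) μ := by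
  refine Integrable.of_integral_ne_zero fun h => ?_
  have h1 := blowMean_exp_neg hm hμ hs
  rw [blowMean, h, mul_zero] at h1
  exact absurd h1.symm (by exact_mod_cast m.factorial_ne_zero)

theorem ExpDominated.integrable {f : Point n → ℝ} (hf : ExpDominated f) {m : ℕ} (hm : 1 ≤ m)
    {μ : Measure (Point n)} (hμ : IsUniform (m : ℝ) μ) {s : ℝ} (hs : 0 < s) :
    Integrable (fun z => f (dil s z)) μ := by
  obtain ⟨hc, K, hK⟩ := hf
  refine ((integrable_exp_neg hm hμ hs).const_mul K).mono'
    (hc.comp (continuous_dil s)).aestronglyMeasurable (ae_of_all _ fun z => hK _)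

theorem abs_blowMean_le {f : Point n → ℝ} {K : ℝ}
    (hK : ∀ w, |f w| ≤ K * Real.exp (-koranyiNorm w)) {m : ℕ} (hm : 1 ≤ m)
    {μ : Measure (Point n)} (hμ : IsUniform (m : ℝ) μ) {s : ℝ} (hs : 0 < s) :
    |blowMean m μ s f| ≤ K * m.factorial := by
  rw [← blowMean_exp_neg hm hμ hs, blowMean, blowMean, abs_mul, abs_of_pos (pow_pos hs m),
    mul_left_comm, ← integral_const_mul]
  gcongr
  exact norm_integral_le_of_norm_le (f := fun z => f (dil s z))
    ((integrable_exp_neg hm hμ hs).const_mul K) (ae_of_all _ fun z => hK (dil s z))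

/-- Gaussians times functions of polynomial growth are dominated. -/
theorem expDominated_gaussian_mul {p : Point n → ℝ} (hp : Continuous p) {C : ℝ}
    (hC : ∀ w, |p w| ≤ C * (1 + koranyiNorm w) ^ 9) :
    ExpDominated fun w => Real.exp (-koranyiNorm w ^ 4) * p w := by
  have hcN := continuous_koranyiNorm (n := n)
  have hC0 : 0 ≤ C := by
    have := (abs_nonneg _).trans (hC 0)
    exact nonneg_of_mul_nonneg_left this
      (pow_pos (by linarith [koranyiNorm_nonneg (0 : Point n)]) 9)
  refine ⟨by fun_prop, C * (Nat.factorial 9 * Real.exp 5), fun w => ?_⟩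
  have hN := koranyiNorm_nonneg w
  rw [abs_mul, Real.abs_exp]
  calc Real.exp (-koranyiNorm w ^ 4) * |p w|
      ≤ Real.exp (1 - koranyiNorm w ^ 4 / 2) * (C * (1 + koranyiNorm w) ^ 9) := by
        refine mul_le_mul (Real.exp_le_exp.2 ?_) (hC w) (abs_nonneg _) (Real.exp_pos _).le
        nlinarith [pow_nonneg hN 4]
    _ = C * ((1 + koranyiNorm w) ^ 9 * Real.exp (1 - koranyiNorm w ^ 4 / 2)) := by ring
    _ ≤ C * ((Nat.factorial 9 * Real.exp 5) * Real.exp (-koranyiNorm w)) :=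
        mul_le_mul_of_nonneg_left (pow_mul_exp_neg_le hN le_rfl) hC0
    _ = _ := by ring

theorem expDominated_gaussian_mul_of_pow {p : Point n → ℝ} (hp : Continuous p) {C : ℝ} (hC0 : 0 ≤ C)
    {k : ℕ} (hk : k ≤ 9) (hC : ∀ w, |p w| ≤ C * koranyiNorm w ^ k) :
    ExpDominated fun w => Real.exp (-koranyiNorm w ^ 4) * p w := by
  refine expDominated_gaussian_mul hp (C := C) fun w => (hC w).trans ?_
  have hN := koranyiNorm_nonneg w
  gcongr
  exact (pow_le_pow_left₀ hN (by linarith) k).trans (pow_le_pow_right₀ (by linarith) hk)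

/-- The averaged Gaussian kernel takes the same value at every point of the support. -/
theorem blowMean_gaussian_eq {m : ℕ} (hm : 1 ≤ m) {μ : Measure (Point n)}
    (hμ : IsUniform (m : ℝ) μ) {s : ℝ} (hs : 0 < s) {x : Point n} (hx : x ∈ μ.support) :
    blowMean m μ s (fun w => Real.exp (-koranyiDist (dil s x) w ^ 4))
      = blowMean m μ s (fun w => Real.exp (-koranyiNorm w ^ 4)) := by
  simp only [blowMean, koranyiNorm_dil hs.le, koranyiDist_dil hs.le, ← koranyiDist_zero (n := n)]
  rw [integral_comp_koranyiDist hm hμ hμ.zero_mem_support (f := fun r => Real.exp (-(s * r) ^ 4))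
    (by fun_prop), integral_comp_koranyiDist hm hμ hx (f := fun r => Real.exp (-(s * r) ^ 4))
    (by fun_prop)]

/-! ### The approximating quadratic polynomials -/

/-- The coefficient matrix of the part of `secondOrder y w` that is quadratic in `y_H`. -/
noncomputable def hessCoeff (w : Point n) (i j : Fin n ⊕ Fin n) : ℝ :=
  4 * (w.1 i * w.1 j) + 2 * (if i = j then ‖w.1‖ ^ 2 else 0)
    + 4 * (sympl n w.1 i * sympl n w.1 j) - 8 * (gradVec w i * gradVec w j)

theorem secondOrder_eq_sum (y w : Point n) : secondOrder y w
    = ∑ i, y.1 i * (-4 * gradVec w i) + ∑ i, ∑ j, y.1 i * y.1 j * hessCoeff w i j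
      + y.2 * (-2 * w.2) := by
  have hi : ∀ v : Horizontal n, inner ℝ v y.1 = ∑ i, y.1 i * v i := fun v => by
    simp [PiLp.inner_apply]
  have hsq : ∀ v : Horizontal n, inner ℝ v y.1 ^ 2 = ∑ i, ∑ j, y.1 i * y.1 j * (v i * v j) := by
    intro v
    rw [hi, sq, Finset.sum_mul_sum]
    exact Finset.sum_congr rfl fun i _ => Finset.sum_congr rfl fun j _ => by ring
  have hn : ‖w.1‖ ^ 2 * ‖y.1‖ ^ 2
      = ∑ i, ∑ j, y.1 i * y.1 j * (if i = j then ‖w.1‖ ^ 2 else 0) := by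
    rw [← real_inner_self_eq_norm_sq y.1, hi, Finset.mul_sum]
    refine Finset.sum_congr rfl fun i _ => ?_
    simp only [mul_ite, mul_zero, Finset.sum_ite_eq, Finset.mem_univ, if_true]
    ring
  have h4 : ∑ i, ∑ j, y.1 i * y.1 j * hessCoeff w i j
      = 4 * inner ℝ w.1 y.1 ^ 2 + 2 * (‖w.1‖ ^ 2 * ‖y.1‖ ^ 2)
        + 4 * inner ℝ (sympl n w.1) y.1 ^ 2 - 8 * inner ℝ (gradVec w) y.1 ^ 2 := by
    rw [hsq, hsq, hsq, hn]
    simp only [Finset.mul_sum, ← Finset.sum_add_distrib, ← Finset.sum_sub_distrib]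
    refine Finset.sum_congr rfl fun i _ => Finset.sum_congr rfl fun j _ => ?_
    rw [hessCoeff]; ring
  have h1 : ∑ i, y.1 i * (-4 * gradVec w i) = -4 * inner ℝ (gradVec w) y.1 := by
    rw [hi, Finset.mul_sum]
    exact Finset.sum_congr rfl fun i _ => by ring
  rw [h4, h1, secondOrder]
  ring

theorem continuous_gradVec : Continuous (gradVec (n := n)) := by
  have h := continuous_sympl (n := n)
  unfold gradVec
  fun_prop

theorem norm_gradVec_sq (w : Point n) : ‖gradVec w‖ ^ 2 = ‖w.1‖ ^ 2 * koranyiNorm w ^ 4 := by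
  rw [gradVec, norm_add_sq_real, norm_smul, norm_smul, real_inner_smul_left, real_inner_smul_right,
    inner_sympl_self, norm_sympl, koranyiNorm_pow_four, mul_pow, mul_pow, Real.norm_eq_abs,
    Real.norm_eq_abs, sq_abs, sq_abs]
  ring

theorem norm_gradVec_le (w : Point n) : ‖gradVec w‖ ≤ koranyiNorm w ^ 3 := by
  have hN := koranyiNorm_nonneg w
  refine le_of_pow_le_pow_left₀ (n := 2) (by norm_num) (by positivity) ?_
  rw [norm_gradVec_sq]
  calc ‖w.1‖ ^ 2 * koranyiNorm w ^ 4 ≤ koranyiNorm w ^ 2 * koranyiNorm w ^ 4 := by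
        gcongr; exact norm_fst_le_koranyiNorm w
    _ = _ := by ring

theorem continuous_hessCoeff (i j : Fin n ⊕ Fin n) :
    Continuous fun w : Point n => hessCoeff w i j := by
  have h := continuous_sympl (n := n)
  have h' := continuous_gradVec (n := n)
  unfold hessCoeff
  have h2 : Continuous fun w : Point n => if i = j then ‖w.1‖ ^ 2 else 0 := by
    split_ifs <;> fun_prop
  fun_prop

theorem expDominated_hessCoeff (i j : Fin n ⊕ Fin n) :
    ExpDominated fun w : Point n => Real.exp (-koranyiNorm w ^ 4) * hessCoeff w i j := by
  refine expDominated_gaussian_mul (continuous_hessCoeff i j) (C := 18) fun w => ?_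
  have hN := koranyiNorm_nonneg w
  have h1 := norm_fst_le_koranyiNorm w
  set N := koranyiNorm w
  have b2 : N ^ 2 ≤ (1 + N) ^ 9 := (pow_le_pow_left₀ hN (by linarith) 2).trans
    (pow_le_pow_right₀ (by linarith) (by norm_num))
  have b6 : N ^ 6 ≤ (1 + N) ^ 9 := (pow_le_pow_left₀ hN (by linarith) 6).trans
    (pow_le_pow_right₀ (by linarith) (by norm_num))
  have prod : ∀ (v : Horizontal n) (M : ℝ), ‖v‖ ≤ M → |v i * v j| ≤ M * M := fun v M hv => by
    rw [abs_mul]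
    exact mul_le_mul ((abs_apply_le_norm v i).trans hv) ((abs_apply_le_norm v j).trans hv)
      (abs_nonneg _) ((norm_nonneg v).trans hv)
  have e1 := prod w.1 N h1
  have e2 := prod (sympl n w.1) N ((norm_sympl w.1).trans_le h1)
  have e3 := prod (gradVec w) (N ^ 3) (norm_gradVec_le w)
  have e4 : |if i = j then ‖w.1‖ ^ 2 else 0| ≤ N * N := by
    split_ifs
    · rw [abs_of_nonneg (by positivity), sq]; gcongr
    · simpa using mul_nonneg hN hN
  have r2 : N * N = N ^ 2 := (sq N).symm
  have r6 : N ^ 3 * N ^ 3 = N ^ 6 := by ring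
  rw [r2] at e1 e2 e4
  rw [r6] at e3
  rw [hessCoeff]
  rw [abs_le] at *
  constructor <;> linarith

theorem expDominated_gradVec (i : Fin n ⊕ Fin n) :
    ExpDominated fun w : Point n => Real.exp (-koranyiNorm w ^ 4) * (-4 * gradVec w i) := by
  have h' := continuous_gradVec (n := n)
  refine expDominated_gaussian_mul_of_pow (by fun_prop) (C := 4) (k := 3) (by norm_num)
    (by norm_num) fun w => ?_
  rw [abs_mul, abs_neg, abs_of_pos (by norm_num : (0 : ℝ) < 4)]
  gcongr
  exact (abs_apply_le_norm _ i).trans (norm_gradVec_le w)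

theorem expDominated_snd :
    ExpDominated fun w : Point n => Real.exp (-koranyiNorm w ^ 4) * (-2 * w.2) := by
  refine expDominated_gaussian_mul_of_pow (by fun_prop) (C := 2) (k := 2) (by norm_num)
    (by norm_num) fun w => ?_
  rw [abs_mul, abs_neg, abs_of_pos (by norm_num : (0 : ℝ) < 2)]
  gcongr
  exact abs_snd_le_koranyiNorm_sq w

theorem expDominated_gaussian :
    ExpDominated fun w : Point n => Real.exp (-koranyiNorm w ^ 4) := by
  simpa using expDominated_gaussian_mul_of_pow (n := n) (p := fun _ => 1) continuous_const
    (C := 1) (k := 0) (by norm_num) (by norm_num) (by simp)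

/-- The Gaussian mean of `f` at scale `1 / s`. -/
noncomputable def gaussMean (m : ℕ) (μ : Measure (Point n)) (s : ℝ) (f : Point n → ℝ) : ℝ :=
  blowMean m μ s fun w => Real.exp (-koranyiNorm w ^ 4) * f w

/-- The linear coefficient of the approximating polynomial at scale `1 / s`. -/
noncomputable def linPart (m : ℕ) (μ : Measure (Point n)) (s : ℝ) : Horizontal n :=
  WithLp.toLp 2 fun i => s⁻¹ * gaussMean m μ s fun w => -4 * gradVec w i

/-- The quadratic coefficient of the approximating polynomial at scale `1 / s`. -/
noncomputable def quadPart (m : ℕ) (μ : Measure (Point n)) (s : ℝ) :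
    Matrix (Fin n ⊕ Fin n) (Fin n ⊕ Fin n) ℝ :=
  Matrix.of fun i j => gaussMean m μ s fun w => hessCoeff w i j

/-- The vertical coefficient of the approximating polynomial at scale `1 / s`. -/
noncomputable def vertPart (m : ℕ) (μ : Measure (Point n)) (s : ℝ) : ℝ :=
  gaussMean m μ s fun w => -2 * w.2

theorem inner_toEuclideanLin_self (Q : Matrix (Fin n ⊕ Fin n) (Fin n ⊕ Fin n) ℝ)
    (v : Horizontal n) :
    inner ℝ v (Matrix.toEuclideanLin Q v) = ∑ i, ∑ j, v i * v j * Q i j := by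
  simp only [PiLp.inner_apply, Matrix.toLpLin_apply, Matrix.mulVec, dotProduct, RCLike.inner_apply,
    conj_trivial, Finset.sum_mul]
  exact Finset.sum_congr rfl fun i _ => Finset.sum_congr rfl fun j _ => by ring

section

variable {m : ℕ} {μ : Measure (Point n)}

theorem integrable_and_gaussMean_secondOrder (hm : 1 ≤ m) (hμ : IsUniform (m : ℝ) μ) {s : ℝ} (hs : 0 < s)
    (y : Point n) : Integrable (fun z => Real.exp (-koranyiNorm (dil s z) ^ 4)
      * secondOrder y (dil s z)) μ ∧
    gaussMean m μ s (secondOrder y) = ∑ i, y.1 i * (gaussMean m μ s fun w => -4 * gradVec w i)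
      + ∑ i, ∑ j, y.1 i * y.1 j * (gaussMean m μ s fun w => hessCoeff w i j)
      + y.2 * gaussMean m μ s fun w => -2 * w.2 := by
  have e : (fun z => Real.exp (-koranyiNorm (dil s z) ^ 4) * secondOrder y (dil s z))
      = fun z => ∑ i, y.1 i * (Real.exp (-koranyiNorm (dil s z) ^ 4) * (-4 * gradVec (dil s z) i))
      + ∑ i, ∑ j, y.1 i * y.1 j * (Real.exp (-koranyiNorm (dil s z) ^ 4) * hessCoeff (dil s z) i j)
      + y.2 * (Real.exp (-koranyiNorm (dil s z) ^ 4) * (-2 * (dil s z).2)) := by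
    funext z
    rw [secondOrder_eq_sum, mul_add, mul_add, Finset.mul_sum, Finset.mul_sum]
    congr 1
    · congr 1
      · exact Finset.sum_congr rfl fun i _ => by ring
      · refine Finset.sum_congr rfl fun i _ => ?_
        rw [Finset.mul_sum]
        exact Finset.sum_congr rfl fun j _ => by ring
    · ring
  have i1 : ∀ i, Integrable (fun z => y.1 i
      * (Real.exp (-koranyiNorm (dil s z) ^ 4) * (-4 * gradVec (dil s z) i))) μ :=
    fun i => ((expDominated_gradVec i).integrable hm hμ hs).const_mul _
  have i2 : ∀ i j, Integrable (fun z => y.1 i * y.1 j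
      * (Real.exp (-koranyiNorm (dil s z) ^ 4) * hessCoeff (dil s z) i j)) μ :=
    fun i j => ((expDominated_hessCoeff i j).integrable hm hμ hs).const_mul _
  have i3 : Integrable (fun z => y.2
      * (Real.exp (-koranyiNorm (dil s z) ^ 4) * (-2 * (dil s z).2))) μ :=
    (expDominated_snd.integrable hm hμ hs).const_mul _
  have I1 := integrable_finsetSum Finset.univ fun i _ => i1 i
  have I2' := fun i => integrable_finsetSum Finset.univ fun j _ => i2 i j
  have I2 := integrable_finsetSum Finset.univ fun i _ => I2' i
  have I12 : Integrable (fun z =>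
      ∑ i, y.1 i * (Real.exp (-koranyiNorm (dil s z) ^ 4) * (-4 * gradVec (dil s z) i))
      + ∑ i, ∑ j, y.1 i * y.1 j
        * (Real.exp (-koranyiNorm (dil s z) ^ 4) * hessCoeff (dil s z) i j)) μ := I1.add I2
  refine ⟨e ▸ I12.add i3, ?_⟩
  simp only [gaussMean, blowMean]
  rw [e, integral_add I12 i3, integral_add I1 I2, integral_finsetSum _ fun i _ => i1 i,
    integral_finsetSum _ fun i _ => I2' i]
  simp_rw [fun i => integral_finsetSum Finset.univ fun j _ => i2 i j, integral_const_mul,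
    mul_add, Finset.mul_sum, mul_left_comm (s ^ m)]

/-- On the support, the approximating polynomials tend to zero as the scale grows. -/
theorem tendsto_approx_zero (hm : 1 ≤ m) (hμ : IsUniform (m : ℝ) μ) {x : Point n}
    (hx : x ∈ μ.support) :
    Tendsto (fun s => inner ℝ (linPart m μ s) x.1
      + inner ℝ x.1 (Matrix.toEuclideanLin (quadPart m μ s) x.1) + vertPart m μ s * x.2)
      (𝓝[>] 0) (𝓝 0) := by
  obtain ⟨K, hK, hexp⟩ := exists_abs_exp_koranyiDist_sub_le n
  set C := K * koranyiNorm x ^ 3 * m.factorial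
  have hlim : Tendsto (fun s : ℝ => s * C) (𝓝[>] 0) (𝓝 0) := by
    have : Tendsto (fun s : ℝ => s * C) (𝓝 0) (𝓝 (0 * C)) := by
      exact (continuous_id.mul continuous_const).tendsto 0
    rw [zero_mul] at this
    exact this.mono_left nhdsWithin_le_nhds
  have hsmall : ∀ᶠ s : ℝ in 𝓝[>] 0, K * (s * koranyiNorm x) ≤ 1 := by
    have : Tendsto (fun s : ℝ => K * (s * koranyiNorm x)) (𝓝 0) (𝓝 (K * (0 * koranyiNorm x))) :=
      (Continuous.tendsto (by fun_prop) 0)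
    rw [zero_mul, mul_zero] at this
    exact (this.mono_left nhdsWithin_le_nhds).eventually_le_const one_pos
  refine squeeze_zero_norm' ?_ hlim
  filter_upwards [self_mem_nhdsWithin, hsmall] with s hs hsm
  have hs : 0 < s := hs
  obtain ⟨hint, hsum⟩ := integrable_and_gaussMean_secondOrder hm hμ hs (dil s x)
  have hval : gaussMean m μ s (secondOrder (dil s x)) = s ^ 2 * (inner ℝ (linPart m μ s) x.1
      + inner ℝ x.1 (Matrix.toEuclideanLin (quadPart m μ s) x.1) + vertPart m μ s * x.2) := by
    rw [hsum, inner_toEuclideanLin_self, mul_add, mul_add, Finset.mul_sum]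
    congr 1
    · congr 1
      · simp only [linPart, dil, PiLp.inner_apply, RCLike.inner_apply, conj_trivial,
          Finset.mul_sum, PiLp.smul_apply, smul_eq_mul]
        refine Finset.sum_congr rfl fun i _ => ?_
        field_simp
      · refine Finset.sum_congr rfl fun i _ => ?_
        rw [Finset.mul_sum]
        refine Finset.sum_congr rfl fun j _ => ?_
        simp only [quadPart, Matrix.of_apply, dil, PiLp.smul_apply, smul_eq_mul]
        ring
    · simp only [vertPart, dil]; ring
  have hN : koranyiNorm (dil s x) = s * koranyiNorm x := koranyiNorm_dil hs.le x
  have hbd : ∀ w, |Real.exp (-koranyiDist (dil s x) w ^ 4) - Real.exp (-koranyiNorm w ^ 4)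
      + Real.exp (-koranyiNorm w ^ 4) * secondOrder (dil s x) w|
      ≤ (K * koranyiNorm (dil s x) ^ 3) * Real.exp (-koranyiNorm w) :=
    fun w => hexp _ w (by rwa [hN])
  have hR := abs_blowMean_le hbd hm hμ hs
  have hgi := expDominated_gaussian.integrable hm hμ hs
  have hcd := continuous_koranyiDist (dil s x)
  -- The kernel centred at `x` is integrable, being the sum of integrable terms and the remainder.
  have hdi : Integrable (fun z => Real.exp (-koranyiDist (dil s x) (dil s z) ^ 4)) μ := by
    refine (hgi.norm.add (hint.norm.add ((integrable_exp_neg hm hμ hs).const_mul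
      (K * koranyiNorm (dil s x) ^ 3)))).mono' ?_ (ae_of_all _ fun z => ?_)
    · exact (Continuous.comp (g := fun w => Real.exp (-koranyiDist (dil s x) w ^ 4))
        (by fun_prop) (continuous_dil s)).aestronglyMeasurable
    · have h1 := hbd (dil s z)
      have h2 := neg_abs_le (Real.exp (-koranyiNorm (dil s z) ^ 4) * secondOrder (dil s x) (dil s z))
      simp only [Pi.add_apply, Real.norm_eq_abs, Real.abs_exp]
      linarith [(abs_le.1 h1).2]
  have hzero : blowMean m μ s (fun w => Real.exp (-koranyiDist (dil s x) w ^ 4)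
      - Real.exp (-koranyiNorm w ^ 4) + Real.exp (-koranyiNorm w ^ 4) * secondOrder (dil s x) w)
      = gaussMean m μ s (secondOrder (dil s x)) := by
    have h1 := blowMean_gaussian_eq hm hμ hs hx
    simp only [blowMean] at h1
    have hsub : Integrable (fun z => Real.exp (-koranyiDist (dil s x) (dil s z) ^ 4)
      - Real.exp (-koranyiNorm (dil s z) ^ 4)) μ := hdi.sub hgi
    simp only [gaussMean, blowMean]
    rw [integral_add hsub hint, integral_sub hdi hgi, mul_add, mul_sub, h1]
    ring
  rw [hzero, hval, abs_mul, abs_of_pos (pow_pos hs 2), hN] at hR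
  rw [Real.norm_eq_abs]
  refine le_of_mul_le_mul_left (hR.trans_eq ?_) (pow_pos hs 2)
  simp only [C]
  ring

theorem exists_abs_gaussMean_le (hm : 1 ≤ m) (hμ : IsUniform (m : ℝ) μ) {f : Point n → ℝ}
    (hf : ExpDominated fun w => Real.exp (-koranyiNorm w ^ 4) * f w) :
    ∃ C, ∀ s, 0 < s → |gaussMean m μ s f| ≤ C := by
  obtain ⟨_, K, hK⟩ := hf
  exact ⟨K * m.factorial, fun s hs => abs_blowMean_le hK hm hμ hs⟩

theorem quadPart_isSymm (s : ℝ) : (quadPart m μ s).IsSymm := by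
  ext i j
  simp only [Matrix.transpose_apply, quadPart, Matrix.of_apply]
  congr 1
  funext w
  simp only [hessCoeff, eq_comm (a := j), mul_comm]

end

/-! ### The trace and the horizontal second moment -/

theorem norm_dil_fst {s : ℝ} (hs : 0 ≤ s) (z : Point n) : ‖(dil s z).1‖ = s * ‖z.1‖ := by
  simp only [dil, norm_smul, Real.norm_eq_abs, abs_of_nonneg hs]

section

variable {m : ℕ} {μ : Measure (Point n)}

theorem sum_hessCoeff_diag (w : Point n) : ∑ i, hessCoeff w i i
    = ‖w.1‖ ^ 2 * (8 + 4 * n - 8 * koranyiNorm w ^ 4) := by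
  have hs : ∀ v : Horizontal n, ∑ i, v i * v i = ‖v‖ ^ 2 := fun v => by
    rw [← real_inner_self_eq_norm_sq, PiLp.inner_apply]; rfl
  simp only [hessCoeff, if_true, Finset.sum_add_distrib, Finset.sum_sub_distrib, ← Finset.mul_sum,
    hs, norm_sympl, norm_gradVec_sq, Finset.sum_const, Finset.card_univ, Fintype.card_sum,
    Fintype.card_fin, nsmul_eq_mul]
  push_cast
  ring

/-- The horizontal second moment of `μ` with Gaussian weight at scale `1 / s`. -/
noncomputable def horizMoment (μ : Measure (Point n)) (s : ℝ) : ℝ :=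
  ∫ z, Real.exp (-(s * koranyiNorm z) ^ 4) * ‖z.1‖ ^ 2 ∂μ

/-- The horizontal second moment of `μ` with the additional weight `‖z‖⁴`. -/
noncomputable def horizMoment' (μ : Measure (Point n)) (s : ℝ) : ℝ :=
  ∫ z, Real.exp (-(s * koranyiNorm z) ^ 4) * (‖z.1‖ ^ 2 * koranyiNorm z ^ 4) ∂μ

theorem integrable_horizMoment (hm : 1 ≤ m) (hμ : IsUniform (m : ℝ) μ) {s : ℝ} (hs : 0 < s) :
    Integrable (fun z => Real.exp (-(s * koranyiNorm z) ^ 4) * ‖z.1‖ ^ 2) μ := by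
  have h : ExpDominated fun w : Point n => Real.exp (-koranyiNorm w ^ 4) * ‖w.1‖ ^ 2 := by
    refine expDominated_gaussian_mul_of_pow (by fun_prop) (C := 1) (k := 2) (by norm_num)
      (by norm_num) fun w => ?_
    rw [abs_of_nonneg (by positivity), one_mul]
    gcongr
    exact norm_fst_le_koranyiNorm w
  refine ((h.integrable hm hμ hs).const_mul (s ^ 2)⁻¹).congr (ae_of_all _ fun z => ?_)
  simp only [koranyiNorm_dil hs.le, norm_dil_fst hs.le]
  field_simp

theorem integrable_horizMoment' (hm : 1 ≤ m) (hμ : IsUniform (m : ℝ) μ) {s : ℝ} (hs : 0 < s) :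
    Integrable (fun z => Real.exp (-(s * koranyiNorm z) ^ 4)
      * (‖z.1‖ ^ 2 * koranyiNorm z ^ 4)) μ := by
  have hcN := continuous_koranyiNorm (n := n)
  have h : ExpDominated fun w : Point n =>
      Real.exp (-koranyiNorm w ^ 4) * (‖w.1‖ ^ 2 * koranyiNorm w ^ 4) := by
    refine expDominated_gaussian_mul_of_pow (by fun_prop) (C := 1) (k := 6) (by norm_num)
      (by norm_num) fun w => ?_
    have hN := koranyiNorm_nonneg w
    rw [abs_of_nonneg (by positivity), one_mul]
    calc ‖w.1‖ ^ 2 * koranyiNorm w ^ 4 ≤ koranyiNorm w ^ 2 * koranyiNorm w ^ 4 := by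
          gcongr; exact norm_fst_le_koranyiNorm w
      _ = _ := by ring
  refine ((h.integrable hm hμ hs).const_mul (s ^ 6)⁻¹).congr (ae_of_all _ fun z => ?_)
  simp only [koranyiNorm_dil hs.le, norm_dil_fst hs.le]
  field_simp

theorem trace_quadPart (hm : 1 ≤ m) (hμ : IsUniform (m : ℝ) μ) {s : ℝ} (hs : 0 < s) :
    (quadPart m μ s).trace
      = s ^ (m + 2) * ((8 + 4 * n) * horizMoment μ s - 8 * s ^ 4 * horizMoment' μ s) := by
  simp only [Matrix.trace, Matrix.diag_apply, quadPart, Matrix.of_apply, gaussMean, blowMean]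
  rw [← Finset.mul_sum,
    ← integral_finsetSum _ fun i _ => (expDominated_hessCoeff i i).integrable hm hμ hs,
    horizMoment, horizMoment', ← integral_const_mul (8 + 4 * (n : ℝ)),
    ← integral_const_mul (8 * s ^ 4), ← integral_sub ((integrable_horizMoment hm hμ hs).const_mul _)
      ((integrable_horizMoment' hm hμ hs).const_mul _), pow_add, mul_assoc]
  congr 1
  rw [← integral_const_mul]
  congr 1
  funext z
  rw [← Finset.mul_sum, sum_hessCoeff_diag]
  simp only [koranyiNorm_dil hs.le, norm_dil_fst hs.le]
  ring

theorem hasDerivAt_horizMoment (hm : 1 ≤ m) (hμ : IsUniform (m : ℝ) μ) {s : ℝ} (hs : 0 < s) :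
    HasDerivAt (horizMoment μ) (-4 * s ^ 3 * horizMoment' μ s) s := by
  have hcN := continuous_koranyiNorm (n := n)
  have h := hasDerivAt_integral_of_dominated_loc_of_deriv_le (μ := μ) (x₀ := s)
    (s := Ioo (s / 2) (2 * s))
    (F := fun s z => Real.exp (-(s * koranyiNorm z) ^ 4) * ‖z.1‖ ^ 2)
    (F' := fun s z => -4 * s ^ 3
      * (Real.exp (-(s * koranyiNorm z) ^ 4) * (‖z.1‖ ^ 2 * koranyiNorm z ^ 4)))
    (bound := fun z => 4 * (2 * s) ^ 3
      * (Real.exp (-(s / 2 * koranyiNorm z) ^ 4) * (‖z.1‖ ^ 2 * koranyiNorm z ^ 4)))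
    (Ioo_mem_nhds (by linarith) (by linarith))
    (Eventually.of_forall fun t => Continuous.aestronglyMeasurable (by fun_prop))
    (integrable_horizMoment hm hμ hs) (Continuous.aestronglyMeasurable (by fun_prop)) ?_
    ((integrable_horizMoment' hm hμ (half_pos hs)).const_mul _) ?_
  · have h2 := h.2
    rwa [integral_const_mul] at h2
  · refine ae_of_all _ fun z t ht => ?_
    have hN := koranyiNorm_nonneg z
    have ht0 : 0 < t := (half_pos hs).trans ht.1
    rw [Real.norm_eq_abs, abs_mul, abs_mul, abs_neg, abs_of_pos (by norm_num : (0 : ℝ) < 4),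
      abs_of_pos (pow_pos ht0 3), abs_of_nonneg (by positivity)]
    have h1 := ht.1.le
    have h2 := ht.2.le
    gcongr
  · refine ae_of_all _ fun z t _ => ?_
    have h1 : HasDerivAt (fun t : ℝ => -(t * koranyiNorm z) ^ 4)
        (-(4 * (t * koranyiNorm z) ^ 3 * koranyiNorm z)) t := by
      have h := (((hasDerivAt_id t).mul_const (koranyiNorm z)).pow 4).neg
      exact h.congr_deriv (by simp)
    exact (h1.exp.mul_const (‖z.1‖ ^ 2)).congr_deriv (by ring)

theorem horizMoment_nonneg (s : ℝ) : 0 ≤ horizMoment μ s :=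
  integral_nonneg fun z => by positivity

theorem exists_horizMoment_le (hm : 1 ≤ m) (hμ : IsUniform (m : ℝ) μ) :
    ∃ C, ∀ s, 0 < s → s ^ (m + 2) * horizMoment μ s ≤ C := by
  have h : ExpDominated fun w : Point n => Real.exp (-koranyiNorm w ^ 4) * ‖w.1‖ ^ 2 := by
    refine expDominated_gaussian_mul_of_pow (by fun_prop) (C := 1) (k := 2) (by norm_num)
      (by norm_num) fun w => ?_
    rw [abs_of_nonneg (by positivity), one_mul]
    gcongr
    exact norm_fst_le_koranyiNorm w
  obtain ⟨C, hC⟩ := exists_abs_gaussMean_le hm hμ h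
  refine ⟨C, fun s hs => ?_⟩
  refine le_trans (le_of_eq ?_) ((le_abs_self _).trans (hC s hs))
  rw [gaussMean, blowMean, horizMoment, pow_add, mul_assoc, ← integral_const_mul]
  congr 2
  funext z
  simp only [koranyiNorm_dil hs.le, norm_dil_fst hs.le]
  ring

/-- If the traces tend to zero then so does the scaled horizontal second moment. Indeed
`s ^ (2n + 4)` times the moment has derivative `s ^ (2n + 1 - m) / 2` times the trace, and
`m < 2n + 2`. -/
theorem tendsto_horizMoment (hm : 1 ≤ m) (hmn : m ≤ 2 * n + 1) (hμ : IsUniform (m : ℝ) μ)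
    (htr : Tendsto (fun s => (quadPart m μ s).trace) (𝓝[>] 0) (𝓝 0)) :
    Tendsto (fun s => s ^ (m + 2) * horizMoment μ s) (𝓝[>] 0) (𝓝 0) := by
  obtain ⟨k, hk⟩ : ∃ k, 2 * n + 1 = m + k := ⟨2 * n + 1 - m, by omega⟩
  obtain ⟨C, hC⟩ := exists_horizMoment_le hm hμ
  have hk' : (2 : ℝ) * n + 1 = m + k := by exact_mod_cast hk
  refine tendsto_order.2 ⟨fun a ha => ?_, fun ε hε => ?_⟩
  · filter_upwards [self_mem_nhdsWithin] with s hs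
    exact ha.trans_le (mul_nonneg (pow_nonneg (le_of_lt hs) _) (horizMoment_nonneg s))
  have hev : ∀ᶠ s in 𝓝[>] (0 : ℝ), (quadPart m μ s).trace < ε := (tendsto_order.1 htr).2 ε hε
  obtain ⟨δ, hδ, hsub⟩ := mem_nhdsGT_iff_exists_Ioo_subset.1 hev
  have hδ : 0 < δ := hδ
  set ψ : ℝ → ℝ := fun s => s ^ (2 * n + 4) * horizMoment μ s - ε / (2 * (k + 1)) * s ^ (k + 1)
    with hψ
  have hderiv : ∀ s, 0 < s →
      HasDerivAt ψ (s ^ k / 2 * ((quadPart m μ s).trace - ε)) s := fun s hs => by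
    have h1 := ((hasDerivAt_pow (2 * n + 4) s).mul (hasDerivAt_horizMoment hm hμ hs)).sub
      ((hasDerivAt_pow (k + 1) s).const_mul (ε / (2 * (k + 1))))
    refine HasDerivAt.congr_deriv (f := ψ) h1 ?_
    rw [trace_quadPart hm hμ hs, show 2 * n + 4 - 1 = k + (m + 2) by omega,
      show 2 * n + 4 = k + (m + 2) + 1 by omega, Nat.add_sub_cancel]
    push_cast
    rw [show (n : ℝ) = (m + k - 1) / 2 by linarith]
    field_simp
    ring
  have hanti : AntitoneOn ψ (Ioo 0 δ) := by
    refine antitoneOn_of_deriv_nonpos (convex_Ioo _ _)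
      (fun s hs => (hderiv s hs.1).continuousAt.continuousWithinAt)
      (fun s hs => ?_) (fun s hs => ?_)
    · rw [interior_Ioo] at hs
      exact (hderiv s hs.1).differentiableAt.differentiableWithinAt
    · rw [interior_Ioo] at hs
      rw [(hderiv s hs.1).deriv]
      have h1 : (quadPart m μ s).trace < ε := hsub hs
      exact mul_nonpos_of_nonneg_of_nonpos (by have := hs.1.le; positivity) (by linarith)
  -- `ψ` is decreasing and bounded above by a function that vanishes at `0`, so it is nonpositive.
  have hψ0 : Tendsto (fun s => s ^ (k + 1) * C) (𝓝[>] (0 : ℝ)) (𝓝 0) := by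
    have : Tendsto (fun s : ℝ => s ^ (k + 1) * C) (𝓝 0) (𝓝 (0 ^ (k + 1) * C)) :=
      Continuous.tendsto (by fun_prop) 0
    rw [zero_pow (by omega), zero_mul] at this
    exact this.mono_left nhdsWithin_le_nhds
  have hsplit : ∀ s : ℝ, s ^ (2 * n + 4) * horizMoment μ s
      = s ^ (k + 1) * (s ^ (m + 2) * horizMoment μ s) := fun s => by
    rw [show 2 * n + 4 = (k + 1) + (m + 2) by omega, pow_add, mul_assoc]
  filter_upwards [Ioo_mem_nhdsGT hδ] with s hs
  have hle : ψ s ≤ 0 := by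
    refine ge_of_tendsto hψ0 ?_
    filter_upwards [Ioo_mem_nhdsGT hs.1] with t ht
    have ht0 : 0 < t := ht.1
    refine (hanti ⟨ht.1, ht.2.trans hs.2⟩ hs ht.2.le).trans ?_
    simp only [hψ, hsplit]
    have h1 : t ^ (k + 1) * (t ^ (m + 2) * horizMoment μ t) ≤ t ^ (k + 1) * C := by
      gcongr
      exact hC t ht0
    have h2 : 0 ≤ ε / (2 * (k + 1)) * t ^ (k + 1) := by positivity
    linarith
  simp only [hψ, hsplit] at hle
  have hsk : 0 < s ^ (k + 1) := pow_pos hs.1 _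
  have h3 : s ^ (m + 2) * horizMoment μ s ≤ ε / (2 * (k + 1)) := by
    refine le_of_mul_le_mul_left ?_ hsk
    linarith
  refine h3.trans_lt ?_
  rw [div_lt_iff₀ (by positivity)]
  have : (0 : ℝ) ≤ k := k.cast_nonneg
  nlinarith

/-- Vanishing of the horizontal second moment at infinity makes the support asymptotically
vertical: a point of the support at horizontal distance `ε R` from the axis carries a ball of mass
comparable to `(ε R) ^ m` on which the integrand is bounded below. -/
theorem exists_norm_fst_le (hm : 1 ≤ m) (hμ : IsUniform (m : ℝ) μ)
    (h : Tendsto (fun s => s ^ (m + 2) * horizMoment μ s) (𝓝[>] 0) (𝓝 0)) {ε : ℝ} (hε : 0 < ε)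
    (hε1 : ε ≤ 1) :
    ∃ R₀, 0 < R₀ ∧ ∀ R, R₀ ≤ R → ∀ z ∈ μ.support, koranyiNorm z ≤ R → ‖z.1‖ ≤ ε * R := by
  have hev := (tendsto_order.1 h).2 (Real.exp (-52) * (ε / 2) ^ (m + 2)) (by positivity)
  obtain ⟨δ, hδ, hsub⟩ := mem_nhdsGT_iff_exists_Ioo_subset.1 hev
  have hδ : 0 < δ := hδ
  refine ⟨2 / δ, by positivity, fun R hR z hz hzR => ?_⟩
  by_contra! hcon
  have hR0 : 0 < R := lt_of_lt_of_le (by positivity) hR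
  have hs : R⁻¹ ∈ Ioo 0 δ := by
    refine ⟨by positivity, ?_⟩
    rw [inv_lt_comm₀ hR0 hδ]
    refine lt_of_lt_of_le ?_ hR
    rw [inv_eq_one_div]; gcongr; norm_num
  have hlt : R⁻¹ ^ (m + 2) * horizMoment μ R⁻¹ < Real.exp (-52) * (ε / 2) ^ (m + 2) := hsub hs
  refine absurd hlt (not_lt.2 ?_)
  set ρ := ε * R / 2 with hρ
  have hρ0 : 0 < ρ := by positivity
  have hρR : ρ ≤ R := by nlinarith
  have hB : μ (koranyiBall z ρ) = ENNReal.ofReal (ρ ^ m) := measure_koranyiBall hμ hz hρ0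
  have hBm : MeasurableSet (koranyiBall z ρ) := by
    rw [← preimage_koranyiDist_Iic]
    exact (continuous_koranyiDist z).measurable measurableSet_Iic
  have hz1 : ‖z.1‖ ≤ R := (norm_fst_le_koranyiNorm z).trans hzR
  have hz2 : |z.2| ≤ R ^ 2 := (abs_snd_le_koranyiNorm_sq z).trans
    (pow_le_pow_left₀ (koranyiNorm_nonneg z) hzR 2)
  -- On this ball `|w_H| ≤ 2 R` and `|w_T| ≤ 6 R²`, so `‖w‖⁴ ≤ (16 + 36) R⁴`.
  have hlow : ∀ w ∈ koranyiBall z ρ, Real.exp (-52) * ρ ^ 2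
      ≤ Real.exp (-(R⁻¹ * koranyiNorm w) ^ 4) * ‖w.1‖ ^ 2 := by
    intro w hw
    have hd : koranyiDist z w ≤ ρ := by rw [koranyiDist_comm]; exact hw
    have h4 := koranyiDist_pow_four z w
    have hd4 : koranyiDist z w ^ 4 ≤ ρ ^ 4 := pow_le_pow_left₀ (koranyiDist_nonneg _ _) hd 4
    have h1 : ‖w.1 - z.1‖ ≤ ρ := by
      refine le_of_pow_le_pow_left₀ (n := 4) (by norm_num) hρ0.le ?_
      linarith [sq_nonneg (w.2 - z.2 - 2 * inner ℝ z.1 (sympl n w.1))]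
    have h2 : |w.2 - z.2 - 2 * inner ℝ z.1 (sympl n w.1)| ≤ ρ ^ 2 := by
      refine abs_le_of_sq_le_sq ?_ (by positivity)
      have : (0 : ℝ) ≤ ‖w.1 - z.1‖ ^ 4 := by positivity
      calc _ ≤ ρ ^ 4 := by linarith
        _ = _ := by ring
    have hwl : ρ ≤ ‖w.1‖ := by
      have := norm_sub_norm_le z.1 w.1
      rw [norm_sub_rev] at this
      linarith
    have hwu : ‖w.1‖ ≤ 2 * R := by
      have := norm_sub_norm_le w.1 z.1
      linarith
    have hin : |inner ℝ z.1 (sympl n w.1)| ≤ R * (2 * R) :=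
      (abs_inner_sympl_le z.1 w.1).trans (by gcongr)
    have hρ2 : ρ ^ 2 ≤ R ^ 2 := by gcongr
    have hw2 : |w.2| ≤ 6 * R ^ 2 := by
      rw [abs_le] at *
      constructor <;> nlinarith
    have hN : koranyiNorm w ^ 4 ≤ 52 * R ^ 4 := by
      rw [koranyiNorm_pow_four]
      have a1 : ‖w.1‖ ^ 4 ≤ (2 * R) ^ 4 := by gcongr
      have a2 : w.2 ^ 2 ≤ (6 * R ^ 2) ^ 2 := sq_le_sq' (abs_le.1 hw2).1 (abs_le.1 hw2).2
      calc _ ≤ (2 * R) ^ 4 + (6 * R ^ 2) ^ 2 := add_le_add a1 a2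
        _ = _ := by ring
    have hN' : (R⁻¹ * koranyiNorm w) ^ 4 ≤ 52 := by
      rw [mul_pow, inv_pow, inv_mul_le_iff₀ (by positivity)]
      linarith
    gcongr
  have hint := integrable_horizMoment hm hμ hs.1
  have hmoment : ρ ^ m * (Real.exp (-52) * ρ ^ 2) ≤ horizMoment μ R⁻¹ := by
    have h1 : ∫ _ in koranyiBall z ρ, Real.exp (-52) * ρ ^ 2 ∂μ
        = ρ ^ m * (Real.exp (-52) * ρ ^ 2) := by
      rw [setIntegral_const, measureReal_def, hB, ENNReal.toReal_ofReal (by positivity),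
        smul_eq_mul]
    rw [← h1]
    refine (setIntegral_mono_on ?_ hint.integrableOn hBm hlow).trans
      (setIntegral_le_integral hint (ae_of_all _ fun z => by simp only [Pi.zero_apply]; positivity))
    exact integrableOn_const (by rw [hB]; exact ENNReal.ofReal_ne_top)
  calc Real.exp (-52) * (ε / 2) ^ (m + 2)
      = R⁻¹ ^ (m + 2) * (ρ ^ m * (Real.exp (-52) * ρ ^ 2)) := by
        rw [hρ]
        have : ε * R / 2 = ε / 2 * R := by ring
        rw [this, mul_pow, mul_pow, inv_pow, pow_add, pow_add]
        field_simp
    _ ≤ _ := by gcongr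

end

/-! ### Approximately uniform measures on the line -/

/-- Near `0`, the measure `ν` on the line gives intervals of radius `ρ` about points of `K` a mass
that agrees with `ρ ^ (m / 2)` up to an error `κ` in the radius; and `ν` is carried by `K ∋ 0`. -/
structure IsApproxUniform (m : ℕ) (κ : ℝ) (ν : Measure ℝ) (K : Set ℝ) : Prop where
  zero_mem : 0 ∈ K
  null : ∀ A, MeasurableSet A → Disjoint A K → ν A = 0
  lower : ∀ x ∈ K, |x| ≤ 1 / 4 → ∀ ρ, κ < ρ → ρ ≤ 1 / 8 →
    ENNReal.ofReal (√(ρ - κ) ^ m) ≤ ν (Icc (x - ρ) (x + ρ))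
  upper : ∀ x ∈ K, |x| ≤ 1 / 4 → ∀ ρ, κ < ρ → ρ ≤ 1 / 8 →
    ν (Icc (x - ρ) (x + ρ)) ≤ ENNReal.ofReal (√(ρ + κ) ^ m)

namespace IsApproxUniform

variable {m : ℕ} {κ : ℝ} {ν : Measure ℝ} {K : Set ℝ}

theorem measure_le (h : IsApproxUniform m κ ν K) {A B : Set ℝ} (hA : MeasurableSet A)
    (hB : MeasurableSet B) (hAB : ∀ t ∈ A, t ∈ K → t ∈ B) : ν A ≤ ν B := by
  have h0 : ν (A \ B) = 0 := h.null _ (hA.diff hB)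
    (disjoint_left.2 fun t ht htK => ht.2 (hAB t ht.1 htK))
  calc ν A ≤ ν (B ∪ A \ B) := measure_mono fun t ht => by
        by_cases htB : t ∈ B
        · exact Or.inl htB
        · exact Or.inr ⟨ht, htB⟩
    _ ≤ ν B + ν (A \ B) := measure_union_le _ _
    _ = ν B := by rw [h0, add_zero]

theorem sqrt_pow_lt (hm : 1 ≤ m) {a b : ℝ} (ha : 0 ≤ a) (hab : a < b) : √a ^ m < √b ^ m :=
  pow_lt_pow_left₀ (Real.sqrt_lt_sqrt ha hab) (Real.sqrt_nonneg _) (by omega)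

/-- There are no gaps of length `16 κ`. At the left end `a` of a gap there is a slightly
smaller point `x` of `K`, and a suitable interval about `x` contains the same part of `K` as a longer
one about `a`. -/
theorem exists_mem_Icc (h : IsApproxUniform m κ ν K) (hm : 1 ≤ m) (hκ : 0 < κ) {p q : ℝ}
    (hp : 0 ≤ p) (hq : q ≤ 1 / 8) (hpq : 16 * κ ≤ q - p) : ∃ t ∈ K, t ∈ Icc p q := by
  by_contra! hgap
  set A := {t | t ∈ K ∧ 0 ≤ t ∧ t ≤ p}
  have hAne : A.Nonempty := ⟨0, h.zero_mem, le_rfl, hp⟩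
  have hAbdd : BddAbove A := ⟨p, fun t ht => ht.2.2⟩
  obtain ⟨a, ⟨haK, ha0, hap⟩, ha⟩ := exists_lt_of_lt_csSup hAne (sub_lt_self (sSup A) hκ)
  have hno : ∀ t ∈ K, t ≤ q → t ≤ a + κ := by
    intro t htK htq
    by_contra! hlt
    have htA : t ∉ A := fun htA => by linarith [le_csSup hAbdd htA]
    have htp : p < t := by
      by_contra! htp
      exact htA ⟨htK, by linarith, htp⟩
    exact hgap t htK ⟨htp.le, htq⟩
  have haabs : |a| ≤ 1 / 4 := abs_le.2 ⟨by linarith, by linarith⟩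
  -- The interval of radius `5 κ` about `a` has more mass than the one of radius `2 κ`; the extra mass
  -- cannot lie to the right of `a`.
  obtain ⟨x, hxK, hx1, hx2⟩ : ∃ x ∈ K, a - 5 * κ ≤ x ∧ x < a - 2 * κ := by
    by_contra! hcon
    have hle := h.measure_le (A := Icc (a - 5 * κ) (a + 5 * κ)) (B := Icc (a - 2 * κ) (a + 2 * κ))
      measurableSet_Icc measurableSet_Icc fun t ht htK =>
        ⟨hcon t htK ht.1, by linarith [hno t htK (by linarith [ht.2])]⟩
    have h1 := (h.lower a haK haabs (5 * κ) (by linarith) (by linarith)).trans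
      (hle.trans (h.upper a haK haabs (2 * κ) (by linarith) (by linarith)))
    rw [ENNReal.ofReal_le_ofReal_iff (by positivity)] at h1
    exact absurd h1 (not_le.2 (sqrt_pow_lt hm (by linarith) (by linarith)))
  have hle := h.measure_le (A := Icc (a - (8 * κ + (a - x))) (a + (8 * κ + (a - x))))
    (B := Icc (x - 8 * κ) (x + 8 * κ)) measurableSet_Icc measurableSet_Icc fun t ht htK =>
      ⟨by linarith [ht.1], by linarith [hno t htK (by linarith [ht.2])]⟩
  have h1 := (h.lower a haK haabs (8 * κ + (a - x)) (by linarith) (by linarith)).trans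
    (hle.trans (h.upper x hxK (abs_le.2 ⟨by linarith, by linarith⟩) (8 * κ) (by linarith)
      (by linarith)))
  rw [ENNReal.ofReal_le_ofReal_iff (by positivity)] at h1
  exact absurd h1 (not_le.2 (sqrt_pow_lt hm (by linarith) (by linarith)))

/-- Comparison of an interval with its two halves. -/
theorem sqrt_pow_doubling (h : IsApproxUniform m κ ν K) (hm : 1 ≤ m) (hκ : 0 < κ)
    (hκ1 : κ ≤ 1 / 1000) :
    √(1 / 16 - κ) ^ m ≤ 2 * √(1 / 32 + 17 * κ) ^ m ∧
      2 * √(1 / 32 - 17 * κ) ^ m ≤ √(1 / 16 + 17 * κ) ^ m := by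
  obtain ⟨c, hcK, hc1, hc2⟩ := h.exists_mem_Icc hm hκ (p := 1 / 16) (q := 1 / 16 + 16 * κ)
    (by norm_num) (by linarith) (by linarith)
  obtain ⟨d, hdK, hd1, hd2⟩ := h.exists_mem_Icc hm hκ (p := 1 / 32) (q := 1 / 32 + 16 * κ)
    (by norm_num) (by linarith) (by linarith)
  obtain ⟨e, heK, he1, he2⟩ := h.exists_mem_Icc hm hκ (p := 3 / 32) (q := 3 / 32 + 16 * κ)
    (by norm_num) (by linarith) (by linarith)
  have hc : |c| ≤ 1 / 4 := abs_le.2 ⟨by linarith, by linarith⟩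
  have hd : |d| ≤ 1 / 4 := abs_le.2 ⟨by linarith, by linarith⟩
  have he : |e| ≤ 1 / 4 := abs_le.2 ⟨by linarith, by linarith⟩
  have two : ∀ t : ℝ, 0 ≤ t → ENNReal.ofReal t + ENNReal.ofReal t = ENNReal.ofReal (2 * t) :=
    fun t ht => by rw [← ENNReal.ofReal_add ht ht, two_mul]
  constructor
  · have hsub : Icc (c - 1 / 16) (c + 1 / 16) ⊆ Icc (d - (1 / 32 + 16 * κ)) (d + (1 / 32 + 16 * κ))
        ∪ Icc (e - (1 / 32 + 16 * κ)) (e + (1 / 32 + 16 * κ)) := by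
      rintro t ⟨ht1, ht2⟩
      rcases le_total t (1 / 16) with ht | ht
      · exact Or.inl ⟨by linarith, by linarith⟩
      · exact Or.inr ⟨by linarith, by linarith⟩
    have h1 := (h.lower c hcK hc (1 / 16) (by linarith) (by linarith)).trans
      ((measure_mono hsub).trans ((measure_union_le _ _).trans (add_le_add
        (h.upper d hdK hd (1 / 32 + 16 * κ) (by linarith) (by linarith))
        (h.upper e heK he (1 / 32 + 16 * κ) (by linarith) (by linarith)))))
    rw [two _ (by positivity), ENNReal.ofReal_le_ofReal_iff (by positivity)] at h1
    rwa [show 1 / 32 + 17 * κ = 1 / 32 + 16 * κ + κ by ring]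
  · have hdisj : Disjoint (Icc (d - (1 / 32 - 16 * κ)) (d + (1 / 32 - 16 * κ)))
        (Icc (e - (1 / 32 - 16 * κ)) (e + (1 / 32 - 16 * κ))) :=
      disjoint_left.2 fun t ht ht' => by linarith [ht.2, ht'.1]
    have hsub : Icc (d - (1 / 32 - 16 * κ)) (d + (1 / 32 - 16 * κ))
        ∪ Icc (e - (1 / 32 - 16 * κ)) (e + (1 / 32 - 16 * κ))
        ⊆ Icc (c - (1 / 16 + 16 * κ)) (c + (1 / 16 + 16 * κ)) := by
      rintro t (⟨ht1, ht2⟩ | ⟨ht1, ht2⟩) <;> exact ⟨by linarith, by linarith⟩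
    have h1 := (add_le_add
        (h.lower d hdK hd (1 / 32 - 16 * κ) (by linarith) (by linarith))
        (h.lower e heK he (1 / 32 - 16 * κ) (by linarith) (by linarith))).trans
      ((measure_union hdisj measurableSet_Icc).symm.le.trans ((measure_mono hsub).trans
        (h.upper c hcK hc (1 / 16 + 16 * κ) (by linarith) (by linarith))))
    rw [two _ (by positivity), ENNReal.ofReal_le_ofReal_iff (by positivity)] at h1
    rwa [show 1 / 32 - 17 * κ = 1 / 32 - 16 * κ - κ by ring,
      show 1 / 16 + 17 * κ = 1 / 16 + 16 * κ + κ by ring]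

/-- Measures on the line that are approximately uniform of dimension `m / 2` to every accuracy only
exist for `m / 2 = 1`. -/
theorem eq_two (hm : 1 ≤ m)
    (h : ∀ κ : ℝ, 0 < κ → κ ≤ 1 / 1000 → ∃ ν K, IsApproxUniform m κ ν K) : m = 2 := by
  have hev : ∀ᶠ κ : ℝ in 𝓝[>] 0, √(1 / 16 - κ) ^ m ≤ 2 * √(1 / 32 + 17 * κ) ^ m ∧
      2 * √(1 / 32 - 17 * κ) ^ m ≤ √(1 / 16 + 17 * κ) ^ m := by
    filter_upwards [Ioo_mem_nhdsGT (show (0 : ℝ) < 1 / 1000 by norm_num)] with κ hκ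
    obtain ⟨ν, K, hK⟩ := h κ hκ.1 hκ.2.le
    exact hK.sqrt_pow_doubling hm hκ.1 hκ.2.le
  have lim : ∀ f : ℝ → ℝ, Continuous f → Tendsto f (𝓝[>] 0) (𝓝 (f 0)) := fun f hf =>
    (hf.tendsto 0).mono_left nhdsWithin_le_nhds
  have h1 := le_of_tendsto_of_tendsto (lim (fun κ => √(1 / 16 - κ) ^ m) (by fun_prop))
    (lim (fun κ => 2 * √(1 / 32 + 17 * κ) ^ m) (by fun_prop)) (hev.mono fun _ h => h.1)
  have h2 := le_of_tendsto_of_tendsto (lim (fun κ => 2 * √(1 / 32 - 17 * κ) ^ m) (by fun_prop))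
    (lim (fun κ => √(1 / 16 + 17 * κ) ^ m) (by fun_prop)) (hev.mono fun _ h => h.2)
  simp only [mul_zero, sub_zero, add_zero] at h1 h2
  have heq : √(1 / 16) ^ m = 2 * √(1 / 32) ^ m := le_antisymm h1 h2
  have hsplit : √(1 / 16 : ℝ) = √2 * √(1 / 32) := by
    rw [← Real.sqrt_mul (by norm_num)]; norm_num
  rw [hsplit, mul_pow] at heq
  have h3 : √2 ^ m = 2 := mul_right_cancel₀ (by positivity) heq
  have h4 : √2 ^ m = √2 ^ 2 := by rw [h3]; norm_num
  exact (pow_right_injective₀ (by positivity) (Real.lt_sqrt_of_sq_lt (by norm_num)).ne') h4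

end IsApproxUniform

/-! ### Asymptotically vertical uniform measures -/

section

variable {m : ℕ} {μ : Measure (Point n)}

/-- If the support is within `κ R` of the vertical axis at all large scales `R`, then the vertical
coordinate rescaled by `R²` pushes `μ` to an approximately uniform measure on the line. -/
theorem isApproxUniform_of_flat (hμ : IsUniform (m : ℝ) μ) {κ R₀ : ℝ}
    (hκ : 0 < κ) (hκ1 : κ ≤ 1 / 1000) (hR₀ : 0 < R₀)
    (hflat : ∀ R, R₀ ≤ R → ∀ z ∈ μ.support, koranyiNorm z ≤ R → ‖z.1‖ ≤ κ * R) :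
    ∃ ν K, IsApproxUniform m κ ν K := by
  -- A point of the support of small height is also of small norm: at the scale of its own norm it
  -- would otherwise be nearly vertical, hence of height comparable to the square of its norm.
  have hnear : ∀ z ∈ μ.support, |z.2| ≤ R₀ ^ 2 / 2 → ‖z.1‖ ≤ κ * R₀ := by
    intro z hz hz2
    by_cases hN : koranyiNorm z ≤ R₀
    · exact hflat R₀ le_rfl z hz hN
    · push Not at hN
      have hNpos : 0 < koranyiNorm z := hR₀.trans hN
      have h1 := hflat _ hN.le z hz le_rfl
      have h2 : ‖z.1‖ ^ 4 ≤ (κ * koranyiNorm z) ^ 4 := by gcongr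
      have h3 : z.2 ^ 2 ≤ (R₀ ^ 2 / 2) ^ 2 := sq_le_sq' (abs_le.1 hz2).1 (abs_le.1 hz2).2
      have h4 : R₀ ^ 4 ≤ koranyiNorm z ^ 4 := by gcongr
      have h5 : κ ^ 4 * koranyiNorm z ^ 4 ≤ (1 / 1000) ^ 4 * koranyiNorm z ^ 4 := by gcongr
      have h6 := koranyiNorm_pow_four z
      have h7 : 0 < koranyiNorm z ^ 4 := by positivity
      rw [mul_pow] at h2
      nlinarith
  have hR2 : 0 < R₀ ^ 2 := by positivity
  set T : Point n → ℝ := fun z => z.2 / R₀ ^ 2 with hT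
  have hTm : Measurable T := measurable_snd.div_const _
  have hmeas : ∀ A, MeasurableSet A → (ENNReal.ofReal ((R₀ ^ m)⁻¹) • μ.map T) A
      = ENNReal.ofReal ((R₀ ^ m)⁻¹) * μ (T ⁻¹' A) := fun A hA => by
    rw [Measure.smul_apply, Measure.map_apply hTm hA, smul_eq_mul]
  have hball : ∀ x ∈ μ.support, ∀ ρ : ℝ, 0 < ρ → ENNReal.ofReal ((R₀ ^ m)⁻¹)
      * μ (koranyiBall x (R₀ * √ρ)) = ENNReal.ofReal (√ρ ^ m) := fun x hx ρ hρ => by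
    rw [measure_koranyiBall hμ hx (mul_pos hR₀ (Real.sqrt_pos.2 hρ)),
      ← ENNReal.ofReal_mul (by positivity), mul_pow, inv_mul_cancel_left₀ (by positivity)]
  have hmem : ∀ (x : Point n) (ρ : ℝ) (z : Point n), z ∈ T ⁻¹' Icc (T x - ρ) (T x + ρ) ↔
      |z.2 - x.2| ≤ ρ * R₀ ^ 2 := by
    intro x ρ z
    rw [mem_preimage, ← Real.closedBall_eq_Icc, Metric.mem_closedBall, Real.dist_eq, hT]
    simp only
    rw [← sub_div, abs_div, abs_of_pos hR2, div_le_iff₀ hR2]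
  have hsqrt : ∀ ρ : ℝ, 0 ≤ ρ → (R₀ * √ρ) ^ 4 = (ρ * R₀ ^ 2) ^ 2 := fun ρ hρ => by
    rw [mul_pow, show √ρ ^ 4 = (√ρ ^ 2) ^ 2 by ring, Real.sq_sqrt hρ]; ring
  have hκ2 : κ ^ 2 ≤ κ / 1000 := by nlinarith
  have hinner : ∀ x z : Point n, ‖x.1‖ ≤ κ * R₀ → ‖z.1‖ ≤ κ * R₀ →
      |inner ℝ x.1 (sympl n z.1)| ≤ κ ^ 2 * R₀ ^ 2 := fun x z hx hz => by
    refine (abs_inner_sympl_le x.1 z.1).trans ?_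
    calc ‖x.1‖ * ‖z.1‖ ≤ (κ * R₀) * (κ * R₀) := by gcongr
      _ = _ := by ring
  have hxT : ∀ x : Point n, |T x| ≤ 1 / 4 → |x.2| ≤ 1 / 4 * R₀ ^ 2 := fun x hx => by
    rw [hT] at hx
    simp only at hx
    rwa [abs_div, abs_of_pos hR2, div_le_iff₀ hR2] at hx
  refine ⟨ENNReal.ofReal ((R₀ ^ m)⁻¹) • μ.map T, T '' μ.support,
    ⟨0, hμ.zero_mem_support, by simp [hT]⟩, fun A hA hdisj => ?_, ?_, ?_⟩
  · rw [hmeas A hA]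
    refine mul_eq_zero_of_right _ (measure_mono_null (t := μ.supportᶜ) (fun z hz hzS => ?_)
      (Measure.measure_compl_support (μ := μ)))
    exact disjoint_left.1 hdisj hz ⟨z, hzS, rfl⟩
  · rintro _ ⟨x, hx, rfl⟩ hxa ρ hκρ hρ
    rw [hmeas _ measurableSet_Icc, ← hball x hx _ (sub_pos.2 hκρ)]
    refine mul_le_mul' le_rfl (measure_mono_ae ?_)
    filter_upwards [Measure.support_mem_ae] with z hz hzB
    rw [← preimage_koranyiDist_Iic] at hzB
    refine (hmem x ρ z).2 ?_
    have hx2 := hxT x hxa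
    have hx1 := hnear x hx (hx2.trans (by linarith))
    have hd4 : koranyiDist x z ^ 4 ≤ (R₀ * √(ρ - κ)) ^ 4 :=
      pow_le_pow_left₀ (koranyiDist_nonneg _ _) hzB 4
    rw [koranyiDist_pow_four, hsqrt _ (by linarith)] at hd4
    have hv : |z.2 - x.2 - 2 * inner ℝ x.1 (sympl n z.1)| ≤ (ρ - κ) * R₀ ^ 2 := by
      have h0 : (0 : ℝ) ≤ ‖z.1 - x.1‖ ^ 4 := by positivity
      exact abs_le_of_sq_le_sq (by linarith) (mul_nonneg (by linarith) hR2.le)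
    have hh : ‖z.1 - x.1‖ ≤ R₀ := by
      refine le_of_pow_le_pow_left₀ (n := 4) (by norm_num) hR₀.le ?_
      have h0 := sq_nonneg (z.2 - x.2 - 2 * inner ℝ x.1 (sympl n z.1))
      have h1 : ((ρ - κ) * R₀ ^ 2) ^ 2 ≤ (1 * R₀ ^ 2) ^ 2 := by
        refine pow_le_pow_left₀ (mul_nonneg (by linarith) hR2.le) ?_ 2
        gcongr
        linarith
      calc _ ≤ (1 * R₀ ^ 2) ^ 2 := by linarith
        _ = _ := by ring
    have hz1 : ‖z.1‖ ≤ 2 * R₀ := by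
      have h1 := norm_sub_norm_le z.1 x.1
      have h2 : κ * R₀ ≤ 1 * R₀ := by gcongr; linarith
      linarith
    -- A first crude bound on `z_T` places `z` in the region where the support is flat.
    have hin1 : |inner ℝ x.1 (sympl n z.1)| ≤ 2 / 1000 * R₀ ^ 2 := by
      refine (abs_inner_sympl_le x.1 z.1).trans ?_
      calc ‖x.1‖ * ‖z.1‖ ≤ (1 / 1000 * R₀) * (2 * R₀) := by
            gcongr
            exact hx1.trans (by gcongr)
        _ = _ := by ring
    have hρR : ρ * R₀ ^ 2 ≤ 1 / 8 * R₀ ^ 2 := by gcongr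
    have hκR : 0 ≤ κ * R₀ ^ 2 := by positivity
    have hz2 : |z.2| ≤ R₀ ^ 2 / 2 := by
      rw [abs_le] at hv hin1 hx2 ⊢
      constructor <;> linarith
    have hin2 := hinner x z hx1 (hnear z hz hz2)
    have hκR2 : κ ^ 2 * R₀ ^ 2 ≤ κ / 1000 * R₀ ^ 2 := by gcongr
    rw [abs_le] at hv hin2 ⊢
    constructor <;> linarith
  · rintro _ ⟨x, hx, rfl⟩ hxa ρ hκρ hρ
    rw [hmeas _ measurableSet_Icc, ← hball x hx _ (by linarith : 0 < ρ + κ)]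
    refine mul_le_mul' le_rfl (measure_mono_ae ?_)
    filter_upwards [Measure.support_mem_ae] with z hz hzB
    have hzx : |z.2 - x.2| ≤ ρ * R₀ ^ 2 := (hmem x ρ z).1 hzB
    have hx2 := hxT x hxa
    have hx1 := hnear x hx (hx2.trans (by linarith))
    have hρR : ρ * R₀ ^ 2 ≤ 1 / 8 * R₀ ^ 2 := by gcongr
    have hz2 : |z.2| ≤ R₀ ^ 2 / 2 := by
      rw [abs_le] at hzx hx2 ⊢
      constructor <;> linarith
    have hz1 := hnear z hz hz2
    have hin := hinner x z hx1 hz1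
    have hmem' : z ∈ koranyiDist x ⁻¹' Iic (R₀ * √(ρ + κ)) := by
      change koranyiDist x z ≤ R₀ * √(ρ + κ)
      refine le_of_pow_le_pow_left₀ (n := 4) (by norm_num) (by positivity) ?_
      rw [koranyiDist_pow_four, hsqrt _ (by linarith)]
      have h1 : ‖z.1 - x.1‖ ≤ 2 * (κ * R₀) := (norm_sub_le _ _).trans (by linarith)
      have h2 : ‖z.1 - x.1‖ ^ 4 ≤ (2 * (κ * R₀)) ^ 4 := by gcongr
      have h3 : (z.2 - x.2 - 2 * inner ℝ x.1 (sympl n z.1)) ^ 2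
          ≤ ((ρ + 2 * κ ^ 2) * R₀ ^ 2) ^ 2 := by
        rw [abs_le] at hzx hin
        refine sq_le_sq' ?_ ?_ <;> linarith
      have h4 : 16 * κ ^ 4 + (ρ + 2 * κ ^ 2) ^ 2 ≤ (ρ + κ) ^ 2 := by
        have h5 : ρ + 6 * κ ^ 2 ≤ ρ + κ := by linarith
        have h6 : (ρ + 6 * κ ^ 2) ^ 2 ≤ (ρ + κ) ^ 2 :=
          pow_le_pow_left₀ (by nlinarith [sq_nonneg κ]) h5 2
        have h7 : 0 ≤ ρ * κ ^ 2 := mul_nonneg (by linarith) (sq_nonneg κ)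
        have h8 : 0 ≤ κ ^ 4 := by positivity
        nlinarith
      calc _ ≤ (2 * (κ * R₀)) ^ 4 + ((ρ + 2 * κ ^ 2) * R₀ ^ 2) ^ 2 := add_le_add h2 h3
        _ = (16 * κ ^ 4 + (ρ + 2 * κ ^ 2) ^ 2) * R₀ ^ 4 := by ring
        _ ≤ (ρ + κ) ^ 2 * R₀ ^ 4 := by gcongr
        _ = _ := by ring
    rwa [preimage_koranyiDist_Iic] at hmem'

/-- The traces of the approximating quadratic forms do not tend to zero unless `m = 2`. -/
theorem eq_two_of_tendsto_trace (hm : 1 ≤ m) (hmn : m ≤ 2 * n + 1) (hμ : IsUniform (m : ℝ) μ)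
    (htr : Tendsto (fun s => (quadPart m μ s).trace) (𝓝[>] 0) (𝓝 0)) : m = 2 := by
  refine IsApproxUniform.eq_two hm fun κ hκ hκ1 => ?_
  obtain ⟨R₀, hR₀, hflat⟩ := exists_norm_fst_le hm hμ (tendsto_horizMoment hm hmn hμ htr) hκ
    (by linarith)
  exact isApproxUniform_of_flat hμ hκ hκ1 hR₀ hflat

end

/-! ### Limits of the approximating polynomials -/

theorem exists_tendsto_of_bounded {l : Filter ℝ} (U : Ultrafilter ℝ) (hU : ↑U ≤ l) {f : ℝ → ℝ}
    {C : ℝ} (h : ∀ᶠ s in l, |f s| ≤ C) : ∃ a, Tendsto f U (𝓝 a) := by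
  obtain ⟨a, -, ha⟩ := (isCompact_Icc (a := -C) (b := C)).ultrafilter_le_nhds (U.map f)
    (le_principal_iff.2 (hU (h.mono fun s hs => abs_le.1 hs)))
  exact ⟨a, ha⟩

/-- If quadratic polynomials with bounded quadratic and vertical coefficients tend to zero on a
set and the traces do not tend to zero, then a limit polynomial with nonzero trace vanishes on
the set. The linear coefficients need not be bounded, but their projections to the span of the
horizontal parts of the set are. -/
theorem exists_quadric_of_tendsto {l : Filter ℝ} {S : Set (Point n)} {b : ℝ → Horizontal n}
    {Q : ℝ → Matrix (Fin n ⊕ Fin n) (Fin n ⊕ Fin n) ℝ} {τ : ℝ → ℝ} (hsymm : ∀ s, (Q s).IsSymm)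
    (hQ : ∀ i j, ∃ C, ∀ᶠ s in l, |Q s i j| ≤ C) (hτ : ∃ C, ∀ᶠ s in l, |τ s| ≤ C)
    (h : ∀ x ∈ S, Tendsto (fun s => inner ℝ (b s) x.1
      + inner ℝ x.1 (Matrix.toEuclideanLin (Q s) x.1) + τ s * x.2) l (𝓝 0))
    (htr : ¬ Tendsto (fun s => (Q s).trace) l (𝓝 0)) :
    ∃ (b : Horizontal n) (T : ℝ) (Q : Matrix (Fin n ⊕ Fin n) (Fin n ⊕ Fin n) ℝ),
      Q.IsSymm ∧ Q.trace ≠ 0 ∧ S ⊆ quadric b Q T := by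
  obtain ⟨ε, hε, hfreq⟩ : ∃ ε > 0, ∃ᶠ s in l, ε ≤ |(Q s).trace| := by
    by_contra! hcon
    refine htr (Metric.tendsto_nhds.2 fun ε hε => ?_)
    filter_upwards [hcon ε hε] with s hs
    rwa [dist_zero_right, Real.norm_eq_abs]
  have : NeBot (l ⊓ 𝓟 {s | ε ≤ |(Q s).trace|}) := frequently_mem_iff_neBot.1 hfreq
  set U := Ultrafilter.of (l ⊓ 𝓟 {s | ε ≤ |(Q s).trace|})
  have hU : ↑U ≤ l := (Ultrafilter.of_le _).trans inf_le_left
  have hUtr : ∀ᶠ s in (U : Filter ℝ), ε ≤ |(Q s).trace| :=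
    le_principal_iff.1 ((Ultrafilter.of_le _).trans inf_le_right)
  choose C hC using hQ
  choose q hq using fun i j => exists_tendsto_of_bounded U hU (hC i j)
  obtain ⟨D, hD⟩ := hτ
  obtain ⟨t, ht⟩ := exists_tendsto_of_bounded U hU hD
  have hquad : ∀ x : Point n, Tendsto (fun s => inner ℝ x.1 (Matrix.toEuclideanLin (Q s) x.1)) U
      (𝓝 (inner ℝ x.1 (Matrix.toEuclideanLin (Matrix.of q) x.1))) := fun x => by
    simp only [inner_toEuclideanLin_self]
    exact tendsto_finsetSum _ fun i _ => tendsto_finsetSum _ fun j _ => (hq i j).const_mul _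
  -- For every `v` in the span, the linear parts evaluated at `v` converge along the ultrafilter.
  set W := Submodule.span ℝ (Prod.fst '' S)
  have hlin : ∀ v ∈ W, ∃ a, Tendsto (fun s => inner ℝ (b s) v) U (𝓝 a) := by
    intro v hv
    induction hv using Submodule.span_induction with
    | mem v hv =>
      obtain ⟨x, hx, rfl⟩ := hv
      refine ⟨_, ((((h x hx).mono_left hU).sub (ht.mul_const x.2)).sub (hquad x)).congr
        fun s => ?_⟩
      ring
    | zero => exact ⟨0, by simp⟩
    | add v w _ _ hv hw =>
      obtain ⟨a, ha⟩ := hv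
      obtain ⟨c, hc⟩ := hw
      exact ⟨a + c, by simpa only [inner_add_right] using ha.add hc⟩
    | smul r v _ hv =>
      obtain ⟨a, ha⟩ := hv
      exact ⟨r * a, by simpa only [real_inner_smul_right] using ha.const_mul r⟩
  choose β hβ using fun i => hlin (W.starProjection (EuclideanSpace.single i 1))
    (Submodule.starProjection_apply_mem _ _)
  refine ⟨WithLp.toLp 2 β, t, Matrix.of q, ?_, ?_, fun x hx => ?_⟩
  · ext i j
    refine tendsto_nhds_unique (hq j i) ((hq i j).congr fun s => ?_)
    exact (hsymm s).apply j i
  · intro h0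
    have htrlim : Tendsto (fun s => |(Q s).trace|) U (𝓝 |(Matrix.of q).trace|) :=
      (tendsto_finsetSum _ fun i _ => hq i i).abs
    have := ge_of_tendsto htrlim hUtr
    rw [h0, abs_zero] at this
    linarith
  · have hxW : x.1 ∈ W := Submodule.subset_span ⟨x, hx, rfl⟩
    have hexp : x.1 = ∑ i, x.1 i • W.starProjection (EuclideanSpace.single i 1) := by
      conv_lhs => rw [← Submodule.starProjection_eq_self_iff.2 hxW]
      conv_lhs => rw [← (EuclideanSpace.basisFun (Fin n ⊕ Fin n) ℝ).sum_repr x.1, map_sum]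
      refine Finset.sum_congr rfl fun i _ => ?_
      rw [map_smul, EuclideanSpace.basisFun_repr, EuclideanSpace.basisFun_apply]
    have hb : Tendsto (fun s => inner ℝ (b s) x.1) U (𝓝 (inner ℝ (WithLp.toLp 2 β) x.1)) := by
      have h1 : Tendsto (fun s => ∑ i, x.1 i
          * inner ℝ (b s) (W.starProjection (EuclideanSpace.single i 1))) U
          (𝓝 (∑ i, x.1 i * β i)) :=
        tendsto_finsetSum _ fun i _ => (hβ i).const_mul _
      have h2 : inner ℝ (WithLp.toLp 2 β) x.1 = ∑ i, x.1 i * β i := by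
        simp [PiLp.inner_apply]
      rw [h2]
      refine h1.congr fun s => ?_
      conv_rhs => rw [hexp]
      simp only [inner_sum, real_inner_smul_right]
    exact tendsto_nhds_unique ((hb.add (hquad x)).add (ht.mul_const x.2))
      ((h x hx).mono_left hU)

theorem IsUniform.exists_support_subset_quadric {m : ℕ} {μ : Measure (Point n)} (hm1 : 1 ≤ m)
    (hmn : m ≤ 2 * n + 1) (hm2 : m ≠ 2) (hμ : IsUniform (m : ℝ) μ) :
    ∃ (b : Horizontal n) (T : ℝ) (Q : Matrix (Fin n ⊕ Fin n) (Fin n ⊕ Fin n) ℝ),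
      Q.IsSymm ∧ Q.trace ≠ 0 ∧ μ.support ⊆ quadric b Q T := by
  have hbdd : ∀ f : Point n → ℝ,
      ExpDominated (fun w => Real.exp (-koranyiNorm w ^ 4) * f w) →
      ∃ C, ∀ᶠ s in 𝓝[>] (0 : ℝ), |gaussMean m μ s f| ≤ C := fun f hf => by
    obtain ⟨C, hC⟩ := exists_abs_gaussMean_le hm1 hμ hf
    exact ⟨C, by filter_upwards [self_mem_nhdsWithin] with s hs using hC s hs⟩
  exact exists_quadric_of_tendsto (l := 𝓝[>] (0 : ℝ)) (b := linPart m μ) (Q := quadPart m μ)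
    (τ := vertPart m μ) quadPart_isSymm (fun i j => hbdd _ (expDominated_hessCoeff i j))
    (hbdd _ expDominated_snd) (fun x hx => tendsto_approx_zero hm1 hμ hx)
    (fun htr => hm2 (eq_two_of_tendsto_trace hm1 hmn hμ htr))

end Heisenberg

theorem mainTheorem2 (n : ℕ) (hn : 1 ≤ n) (m : ℕ) (hm : m ∈ Set.Icc 1 (2 * n + 1) \ {2})
    (μ : MeasureTheory.Measure (Heisenberg.Point n)) (hμ : Heisenberg.IsUniform (m : ℝ) μ) :
    ∃ (b : Heisenberg.Horizontal n) (T : ℝ) (Q : Matrix (Fin n ⊕ Fin n) (Fin n ⊕ Fin n) ℝ),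
      Q.IsSymm ∧ Q.trace ≠ 0 ∧ μ.support ⊆ Heisenberg.quadric b Q T := by
  obtain ⟨⟨hm1, hmn⟩, hm2⟩ := hm
  exact Heisenberg.IsUniform.exists_support_subset_quadric hm1 hmn hm2 hμ
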